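/- Let $D,d\ge 1$ and let $A=(A^m)_{m=0}^{d-1}$ be complex $D\times D$ matrices in left-canonical form, $\sum_m A^{m\dagger}A^m=\mathbb 1$, such that $A$ is normal (for some $L\ge1$ the products $A^{m_1}\cdots A^{m_L}$ span all $D\times D$ matrices). For a fixed boundary matrix $X\neq 0$ consider the translationally invariant (up to boundary conditions) matrix product states $|\Psi_N(X)\rangle=\sum_{\vec m}\mathrm{Tr}(A^{m_1}\cdots A^{m_N}X)\,|\vec m\rangle$. Suppose that they have a global on-site symmetry under a finite group $G$: there is a unitary representation $g\mapsto U_g$ of $G$ on $\mathbb C^d$ such that for all $g\in G$ and all $N$ there is a matrix $X'$ with $U_g^{\otimes N}|\Psi_N(X)\rangle=|\Psi_N(X')\rangle$. Then there are unitary $D\times D$ matrices $V_g$ and phases $e^{i\phi_g}$ with $$\sum_n (U_g)_{mn}A^n=e^{i\phi_g}\,V_g^\dagger A^mV_g\qquad\text{for all } g,m,$$ and for all such $V_g$ and $e^{i\phi_g}$, the $V_g$ form a projective representation of $G$ and the $e^{i\phi_g}$ form a one-dimensional representation of $G$. If moreover $V$ is irreducible, then the following hold with the defects $B^g=V_g$.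 1. *The defects are correctable.* For every $g\in G$ there is $h\in G$ such that, with the $d\times D^2$ matrix $\bar A=\sum_{ijm}A^m_{ij}|m\rangle\langle ij|$, there is a unitary $O$ on $\mathbb C^d$ with $O\bar A=\bar A\,((B^h)^T\otimes B^g)$, and $[(B^h)^T\otimes B^g,\bar A^\dagger\bar A]=0$. 2. *The defects define a valid POVM.* With $|B^g\rangle=\frac1{\sqrt D}\sum_{ij}(B^g_{ij})^*|ij\rangle$, the map $V_B=\frac{D}{\sqrt{|G|}}\sum_{g}|g\rangle\langle B^g|$ satisfies $V_B^\dagger V_B=\mathbb 1$. 3. *Deterministic preparation in constant depth.* For every $N\ge1$, the MPS with entangled boundary conditions $$\frac1{\sqrt D}\sum_{\ell r}\sum_{\vec m}\langle \ell|A^{m_1}\cdots A^{m_N}|r\rangle\,|\vec m\rangle\otimes|\ell r\rangle$$ is prepared exactly, for all measurement outcomes, from a product state by the following protocol (Protocol 1 with one site per block), which is an adaptive circuit with at most five layers, independently of $N$: its gates act within pairs of neighbouring sites, and each site carries four qudits, a physical qudit of dimension $d$, two bond qudits of dimension $D$ and an ancilla of dimension $p=\mathrm{lcm}(|G|,D^2)/D^2$.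 (i) At all sites in parallel, prepare the two bond qudits in $\frac1{\sqrt D}\sum_j|jj\rangle$ and apply to the left bond qudit and the physical qudit, the latter being in the state $|0\rangle$, a unitary of the form $\sum_mA^m\otimes|m\rangle\langle0|+C_\perp$. (ii) For all pairs of neighbouring sites in parallel, apply to the right bond qudit of the left site, the left bond qudit of the right site and an ancilla in the state $|0\rangle$ a unitary extending $V_B\otimes\langle0|$, and measure these qudits in the computational basis. (iii) Depending on all the outcomes, apply in parallel a unitary to each physical qudit and a unitary to the left edge bond qudit. The gates of (i) and (ii) do not depend on $N$. 4. *Boundary conditions.* If the two edge bond qudits of the state in 3 are measured, then the outcome corresponding to a unit vector $\sum_{\ell r}b_{\ell r}|\ell r\rangle$ collapses the physical qudits onto a multiple of $|\Psi_N(b^\dagger)\rangle$, and the probability of this outcome tends to $1/D^2$ as $N\to\infty$. -/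

import Mathlib

open Matrix Filter Topology
open scoped ComplexConjugate Kronecker

noncomputable section

/-! ### Adaptive quantum circuits on finitely many qudits -/

namespace AdaptiveCircuits

variable {W : Type} [Fintype W] [DecidableEq W]

/-- Computational basis states of a register of qudits indexed by `W`, the qudit `w` having
dimension `dim w`. -/
abbrev Config (dim : W → ℕ) : Type := ∀ w : W, Fin (dim w)

/-- A layer of simultaneous local gates. The register is partitioned into cells, any two qudits of a
cell lie at sites at distance at most `r`, and the layer is the tensor product of one unitary for
each cell (idle qudits form cells carrying the identity). Cells are labelled by `W`, which has enough
labels for every partition; an unused label only contributes a global phase. -/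
def IsLocalLayer (dim : W → ℕ) (site : W → ℕ) (r : ℕ)
    (O : Matrix (Config dim) (Config dim) ℂ) : Prop :=
  ∃ cell : W → W,
    (∀ w w' : W, cell w = cell w' → Nat.dist (site w) (site w') ≤ r) ∧
    ∃ M : ∀ c : W, Matrix.unitaryGroup (∀ w : {w : W // cell w = c}, Fin (dim w)) ℂ,
      ∀ x y : Config dim,
        O x y = ∏ c : W,
          (M c : Matrix (∀ w : {w : W // cell w = c}, Fin (dim w))
            (∀ w : {w : W // cell w = c}, Fin (dim w)) ℂ) (fun w => x w) (fun w => y w)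

/-- Adaptive circuits: layers of gates, and layers in which a set `S` of qudits is measured in the
computational basis, everything after a measurement depending arbitrarily on the outcomes. -/
inductive Circuit (dim : W → ℕ) : Type
  | done : Circuit dim
  | gates (O : Matrix (Config dim) (Config dim) ℂ) (next : Circuit dim) : Circuit dim
  | measure (S : Finset W) (next : (∀ w : {w : W // w ∈ S}, Fin (dim w)) → Circuit dim) :
      Circuit dim

/-- The circuit has at most `t` layers, whatever the measurement outcomes. -/
def Circuit.DepthLE {dim : W → ℕ} : Circuit dim → ℕ → Prop
  | .done, _ => True
  | .gates _ _, 0 => False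
  | .gates _ next, t + 1 => next.DepthLE t
  | .measure _ _, 0 => False
  | .measure _ next, t + 1 => ∀ o, (next o).DepthLE t

/-- Every layer of gates in the circuit is a tensor product of unitaries of range `r`. -/
def Circuit.IsLocal {dim : W → ℕ} (site : W → ℕ) (r : ℕ) : Circuit dim → Prop
  | .done => True
  | .gates O next => IsLocalLayer dim site r O ∧ next.IsLocal site r
  | .measure _ next => ∀ o, (next o).IsLocal site r

/-- Unnormalised post-measurement state when the outcome on `S` is `o`. -/
def collapse {dim : W → ℕ} (S : Finset W) (o : ∀ w : {w : W // w ∈ S}, Fin (dim w))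
    (ψ : Config dim → ℂ) : Config dim → ℂ :=
  open Classical in fun x => if ∀ w : {w : W // w ∈ S}, x w = o w then ψ x else 0

/-- The unnormalised final states of the circuit started in `ψ`, over all possible sequences of
measurement outcomes. The squared norm of a final state is the probability of its sequence. -/
def Circuit.finalStates {dim : W → ℕ} : Circuit dim → (Config dim → ℂ) → Set (Config dim → ℂ)
  | .done, ψ => {ψ}
  | .gates O next, ψ => next.finalStates (O *ᵥ ψ)
  | .measure S next, ψ => ⋃ o, (next o).finalStates (collapse S o ψ)

/-- The product state in which every qudit is in its basis state `0`. -/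
def zeroState (dim : W → ℕ) [∀ w, NeZero (dim w)] : Config dim → ℂ :=
  fun x => if x = 0 then 1 else 0

/-- Started from the all-zero product state, the circuit prepares exactly and deterministically the
state `ψ` of the qudits in `out` (`ψ` reads only the coordinates in `out`): for all measurement
outcomes the final state is `ψ` times a state of the remaining qudits (zero for impossible
outcomes). -/
def Circuit.Prepares {dim : W → ℕ} [∀ w, NeZero (dim w)] (C : Circuit dim) (out : Finset W)
    (ψ : Config dim → ℂ) : Prop :=
  ∀ φ ∈ C.finalStates (zeroState dim),
    ∃ χ : (∀ w : {w : W // w ∉ out}, Fin (dim w)) → ℂ, ∀ x, φ x = ψ x * χ (fun w => x w)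

end AdaptiveCircuits

/-! ### Matrix product states -/

namespace MPS

variable {D d : ℕ} {G : Type*} [Group G] [Fintype G]

/-- `A^{m_1} ⋯ A^{m_N}`. -/
def word (A : Fin d → Matrix (Fin D) (Fin D) ℂ) {N : ℕ} (m : Fin N → Fin d) :
    Matrix (Fin D) (Fin D) ℂ :=
  (List.ofFn fun i => A (m i)).prod

/-- Amplitudes of the `N`-site translationally invariant MPS with boundary matrix `X`. -/
def state (A : Fin d → Matrix (Fin D) (Fin D) ℂ) (X : Matrix (Fin D) (Fin D) ℂ) {N : ℕ}
    (m : Fin N → Fin d) : ℂ :=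
  (word A m * X).trace

/-- Amplitudes of the normalised `N`-site MPS with entangled boundary conditions, in which the left
and right boundaries are entangled with two bond qudits (basis states `l` and `r`). -/
def entangledState (A : Fin d → Matrix (Fin D) (Fin D) ℂ) {N : ℕ} (m : Fin N → Fin d)
    (l r : Fin D) : ℂ :=
  ((1 / √(D : ℝ) : ℝ) : ℂ) * word A m l r

/-- Left-canonical form. -/
def LeftCanonical (A : Fin d → Matrix (Fin D) (Fin D) ℂ) : Prop :=
  ∑ m, (A m)ᴴ * A m = 1

/-- Normality: after blocking some finite number of sites the tensor is injective. -/
def IsNormal (A : Fin d → Matrix (Fin D) (Fin D) ℂ) : Prop :=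
  ∃ L : ℕ, 1 ≤ L ∧
    Submodule.span ℂ (Set.range fun m : Fin L → Fin d => word A m) = ⊤

/-- Global on-site symmetry: applying `U g` to every site maps the MPS with boundary matrix `X` to
the MPS of the same tensor with some other boundary matrix, for all system sizes. -/
def HasOnSiteSymmetry (A : Fin d → Matrix (Fin D) (Fin D) ℂ) (X : Matrix (Fin D) (Fin D) ℂ)
    (U : G →* Matrix.unitaryGroup (Fin d) ℂ) : Prop :=
  ∀ (g : G) (N : ℕ), ∃ X' : Matrix (Fin D) (Fin D) ℂ, ∀ m : Fin N → Fin d,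
    ∑ n : Fin N → Fin d, (∏ i, (U g : Matrix (Fin d) (Fin d) ℂ) (m i) (n i)) * state A X n
      = state A X' m

/-- The symmetry acts on the virtual level through the unitaries `V g` and the phases `c g`. The
adjoint stands on the left, so that `V` composes in the same order as `U`. -/
def ActsVirtually (A : Fin d → Matrix (Fin D) (Fin D) ℂ)
    (U : G →* Matrix.unitaryGroup (Fin d) ℂ) (V : G → Matrix.unitaryGroup (Fin D) ℂ)
    (c : G → Circle) : Prop :=
  ∀ (g : G) (m : Fin d),
    ∑ n, (U g : Matrix (Fin d) (Fin d) ℂ) m n • A n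
      = (c g : ℂ) • ((V g : Matrix (Fin D) (Fin D) ℂ)ᴴ * A m * (V g : Matrix (Fin D) (Fin D) ℂ))

/-- Unitary projective representations. -/
def IsProjectiveRep (V : G → Matrix.unitaryGroup (Fin D) ℂ) : Prop :=
  ∃ ω : G → G → Circle, ∀ g h : G,
    (V g : Matrix (Fin D) (Fin D) ℂ) * (V h : Matrix (Fin D) (Fin D) ℂ)
      = (ω g h : ℂ) • (V (g * h) : Matrix (Fin D) (Fin D) ℂ)

/-- No invariant subspaces other than `0` and the whole space. -/
def IsIrreducible (V : G → Matrix.unitaryGroup (Fin D) ℂ) : Prop :=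
  ∀ S : Submodule ℂ (Fin D → ℂ),
    (∀ g : G, ∀ v ∈ S, (V g : Matrix (Fin D) (Fin D) ℂ) *ᵥ v ∈ S) → S = ⊥ ∨ S = ⊤

/-- The virtual-to-physical map of the tensor, a `d × D²` matrix. -/
def virtualToPhysical (A : Fin d → Matrix (Fin D) (Fin D) ℂ) :
    Matrix (Fin d) (Fin D × Fin D) ℂ :=
  Matrix.of fun m ij => A m ij.1 ij.2

/-- Every defect can be pushed through a site: for each `g` there is `h` such that a unitary on the
physical qudit replicates the insertion of `B h` on the left and of `B g` on the right virtual leg;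
equivalently, `(B h)ᵀ ⊗ B g` commutes with the Gram matrix of the virtual-to-physical map. -/
def DefectsCorrectable (A : Fin d → Matrix (Fin D) (Fin D) ℂ)
    (B : G → Matrix.unitaryGroup (Fin D) ℂ) : Prop :=
  ∀ g : G, ∃ h : G,
    (∃ O : Matrix.unitaryGroup (Fin d) ℂ,
      (O : Matrix (Fin d) (Fin d) ℂ) * virtualToPhysical A
        = virtualToPhysical A *
          ((B h : Matrix (Fin D) (Fin D) ℂ)ᵀ ⊗ₖ (B g : Matrix (Fin D) (Fin D) ℂ))) ∧
    Commute ((B h : Matrix (Fin D) (Fin D) ℂ)ᵀ ⊗ₖ (B g : Matrix (Fin D) (Fin D) ℂ))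
      ((virtualToPhysical A)ᴴ * virtualToPhysical A)

/-- The map `V_B = (D / √η) ∑_g |g⟩⟨B^g|` with `η = |G|` and
`|B^g⟩ = (1 / √D) ∑_{ij} (B^g_{ij})^* |ij⟩`. -/
def fusionMap (B : G → Matrix.unitaryGroup (Fin D) ℂ) : Matrix G (Fin D × Fin D) ℂ :=
  Matrix.of fun g ij =>
    (((D : ℝ) / √(Fintype.card G : ℝ) : ℝ) : ℂ) * ((1 / √(D : ℝ) : ℝ) : ℂ)
      * (B g : Matrix (Fin D) (Fin D) ℂ) ij.1 ij.2

/-- The defects define a valid POVM: `V_B` is an isometry. -/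
def IsPOVM (B : G → Matrix.unitaryGroup (Fin D) ℂ) : Prop :=
  (fusionMap B)ᴴ * fusionMap B = 1

/-! ### The preparation protocol, with one site per block -/

/-- Each site carries a left and a right bond qudit, a physical qudit, and an ancilla for the fusion
measurement between this site and the next. -/
inductive Slot : Type
  | left | right | phys | anc
  deriving DecidableEq

instance : Fintype Slot where
  elems := {.left, .right, .phys, .anc}
  complete := fun s => by cases s <;> decide

/-- Dimension of the ancilla that promotes the fusion isometry to a unitary. -/
def ancillaDim (D : ℕ) (G : Type*) [Fintype G] : ℕ :=
  Nat.lcm (Fintype.card G) (D ^ 2) / D ^ 2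

instance ancillaDim_neZero [NeZero D] : NeZero (ancillaDim D G) := by
  refine ⟨?_⟩
  have hD : 0 < D ^ 2 := pow_pos (Nat.pos_of_ne_zero (NeZero.ne D)) 2
  have hl : 0 < Nat.lcm (Fintype.card G) (D ^ 2) := Nat.lcm_pos Fintype.card_pos hD
  exact (Nat.div_pos (Nat.le_of_dvd hl (Nat.dvd_lcm_right _ _)) hD).ne'

/-- Dimensions of the four qudits of a site. -/
@[reducible] def slotDim (D d p : ℕ) : Slot → ℕ
  | .left => D
  | .right => D
  | .phys => d
  | .anc => p

instance slotDim_neZero (D d p : ℕ) [hD : NeZero D] [hd : NeZero d] [hp : NeZero p] (s : Slot) :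
    NeZero (slotDim D d p s) := by
  cases s
  · exact hD
  · exact hD
  · exact hd
  · exact hp

/-- The register for `n + 1` sites. -/
abbrev Wire (n : ℕ) : Type := Fin (n + 1) × Slot

/-- Dimensions of the qudits of the register. -/
@[reducible] def wireDim (D d p n : ℕ) : Wire n → ℕ := fun w => slotDim D d p w.2

instance wireDim_neZero (D d p n : ℕ) [NeZero D] [NeZero d] [NeZero p] (w : Wire n) :
    NeZero (wireDim D d p n w) := slotDim_neZero D d p w.2

/-- Position of a qudit on the line. -/
def wireSite (n : ℕ) : Wire n → ℕ := fun w => w.1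

/-- Basis states of the register. -/
abbrev ChainConfig (D d p n : ℕ) : Type := AdaptiveCircuits.Config (wireDim D d p n)

/-- Matrix elements of the identity. -/
def same {α : Type} [DecidableEq α] (a b : α) : ℂ := if a = b then 1 else 0

/-- Preparation of the bond qudits: the gate `K` acts on the two bond qudits of each site. -/
def bondLayer {p n : ℕ} (K : Matrix (Fin D × Fin D) (Fin D × Fin D) ℂ) :
    Matrix (ChainConfig D d p n) (ChainConfig D d p n) ℂ :=
  Matrix.of fun x y => ∏ i : Fin (n + 1),
    K (x (i, .left), x (i, .right)) (y (i, .left), y (i, .right))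
      * same (x (i, .phys)) (y (i, .phys)) * same (x (i, .anc)) (y (i, .anc))

/-- Sequential preparation: the gate `K` acts on the left bond and the physical qudit of each
site. -/
def siteLayer {p n : ℕ} (K : Matrix (Fin D × Fin d) (Fin D × Fin d) ℂ) :
    Matrix (ChainConfig D d p n) (ChainConfig D d p n) ℂ :=
  Matrix.of fun x y => ∏ i : Fin (n + 1),
    K (x (i, .left), x (i, .phys)) (y (i, .left), y (i, .phys))
      * same (x (i, .right)) (y (i, .right)) * same (x (i, .anc)) (y (i, .anc))

/-- Fusion: the gate `K` acts on the right bond of site `i`, the left bond of site `i + 1` and the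
ancilla of site `i`, for all `i` in parallel. -/
def fusionLayer {p n : ℕ}
    (K : Matrix (Fin D × Fin D × Fin p) (Fin D × Fin D × Fin p) ℂ) :
    Matrix (ChainConfig D d p n) (ChainConfig D d p n) ℂ :=
  Matrix.of fun x y =>
    (∏ i : Fin n,
      K (x (i.castSucc, .right), x (i.succ, .left), x (i.castSucc, .anc))
        (y (i.castSucc, .right), y (i.succ, .left), y (i.castSucc, .anc)))
    * (∏ i : Fin (n + 1), same (x (i, .phys)) (y (i, .phys)))
    * same (x (0, .left)) (y (0, .left))
    * same (x (Fin.last n, .right)) (y (Fin.last n, .right))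
    * same (x (Fin.last n, .anc)) (y (Fin.last n, .anc))

/-- Feedforward: a unitary on the physical qudit of each site and one on the left edge bond. -/
def correctionLayer {p n : ℕ} (K : Fin (n + 1) → Matrix (Fin d) (Fin d) ℂ)
    (E : Matrix (Fin D) (Fin D) ℂ) :
    Matrix (ChainConfig D d p n) (ChainConfig D d p n) ℂ :=
  Matrix.of fun x y =>
    (∏ i : Fin (n + 1), K i (x (i, .phys)) (y (i, .phys)))
    * E (x (0, .left)) (y (0, .left))
    * (∏ i : Fin n, same (x (i.succ, .left)) (y (i.succ, .left)))
    * (∏ i : Fin (n + 1), same (x (i, .right)) (y (i, .right)) * same (x (i, .anc)) (y (i, .anc)))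

/-- The qudits measured in the fusion step: all bond qudits except the two at the edges, and the
ancillas of the fused pairs. -/
def measuredWires (n : ℕ) : Finset (Wire n) :=
  Finset.univ.filter fun w =>
    (w.2 = .left ∧ w.1 ≠ 0) ∨ ((w.2 = .right ∨ w.2 = .anc) ∧ w.1 ≠ Fin.last n)

/-- Measurement outcomes of the fusion step. -/
abbrev Outcome (D d p n : ℕ) : Type :=
  ∀ w : {w : Wire n // w ∈ measuredWires n}, Fin (wireDim D d p n w)

/-- The output qudits: all physical qudits and the two edge bond qudits. -/
def outputWires (n : ℕ) : Finset (Wire n) :=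
  Finset.univ.filter fun w =>
    w.2 = .phys ∨ w = (0, .left) ∨ w = (Fin.last n, .right)

/-- The gates of the protocol for the tensor `A` and the defects `B`, none depending on the number
of sites. -/
structure ProtocolGates [NeZero D] [NeZero d] (A : Fin d → Matrix (Fin D) (Fin D) ℂ)
    (B : G → Matrix.unitaryGroup (Fin D) ℂ) where
  /-- prepares two bond qudits in the maximally entangled state -/
  bond : Matrix.unitaryGroup (Fin D × Fin D) ℂ
  bond_spec : ∀ l r : Fin D,
    (bond : Matrix (Fin D × Fin D) (Fin D × Fin D) ℂ) (l, r) (0, 0)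
      = if l = r then ((1 / √(D : ℝ) : ℝ) : ℂ) else 0
  /-- the unitary embedding `∑_m A^m ⊗ |m⟩⟨0| + C_⊥` of the tensor -/
  site : Matrix.unitaryGroup (Fin D × Fin d) ℂ
  site_spec : ∀ (i j : Fin D) (m : Fin d),
    (site : Matrix (Fin D × Fin d) (Fin D × Fin d) ℂ) (i, m) (j, 0) = A m i j
  /-- encoding of the labels of the defects by computational basis states -/
  code : G ↪ Fin D × Fin D × Fin (ancillaDim D G)
  /-- the unitary `V_B ⊗ ⟨0| + C_⊥` -/
  fusion : Matrix.unitaryGroup (Fin D × Fin D × Fin (ancillaDim D G)) ℂ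
  fusion_spec : ∀ (g : G) (i j : Fin D),
    (fusion : Matrix (Fin D × Fin D × Fin (ancillaDim D G))
      (Fin D × Fin D × Fin (ancillaDim D G)) ℂ) (code g) (i, j, 0) = fusionMap B g (i, j)
  fusion_zero : ∀ (k : Fin D × Fin D × Fin (ancillaDim D G)) (i j : Fin D), k ∉ Set.range code →
    (fusion : Matrix (Fin D × Fin D × Fin (ancillaDim D G))
      (Fin D × Fin D × Fin (ancillaDim D G)) ℂ) k (i, j, 0) = 0

/-- The protocol on `n + 1` sites: prepare single-site MPS with entangled boundaries in parallel,
fuse all neighbours by measurements, and correct the defects by outcome-dependent unitaries `K o i`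
on the physical qudits and `E o` on the left edge bond. -/
def protocol [NeZero D] [NeZero d] {A : Fin d → Matrix (Fin D) (Fin D) ℂ}
    {B : G → Matrix.unitaryGroup (Fin D) ℂ} (P : ProtocolGates A B) (n : ℕ)
    (K : Outcome D d (ancillaDim D G) n → Fin (n + 1) → Matrix.unitaryGroup (Fin d) ℂ)
    (E : Outcome D d (ancillaDim D G) n → Matrix.unitaryGroup (Fin D) ℂ) :
    AdaptiveCircuits.Circuit (wireDim D d (ancillaDim D G) n) :=
  .gates (bondLayer P.bond) <| .gates (siteLayer P.site) <| .gates (fusionLayer P.fusion) <|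
    .measure (measuredWires n) fun o => .gates (correctionLayer (fun i => K o i) (E o)) .done

/-- For every number of sites, the protocol with fusion measurements in the basis given by `B`
prepares exactly and deterministically the MPS with entangled boundary conditions, by an adaptive
circuit with at most five layers and with gates that act within pairs of neighbouring sites. -/
def PreparedByProtocol [NeZero D] [NeZero d] (A : Fin d → Matrix (Fin D) (Fin D) ℂ)
    (B : G → Matrix.unitaryGroup (Fin D) ℂ) : Prop :=
  ∃ P : ProtocolGates A B, ∀ n : ℕ,
    ∃ (K : Outcome D d (ancillaDim D G) n → Fin (n + 1) → Matrix.unitaryGroup (Fin d) ℂ)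
      (E : Outcome D d (ancillaDim D G) n → Matrix.unitaryGroup (Fin D) ℂ),
      (protocol P n K E).DepthLE 5 ∧
      (protocol P n K E).IsLocal (wireSite n) 1 ∧
      (protocol P n K E).Prepares (outputWires n) fun x =>
        entangledState A (fun i => x (i, .phys)) (x (0, .left)) (x (Fin.last n, .right))

/-- Unnormalised state of the physical qudits after the two edge bond qudits of the MPS with
entangled boundary conditions are found in the state `∑ b_{lr} |lr⟩`. -/
def edgeProjected (A : Fin d → Matrix (Fin D) (Fin D) ℂ) (b : Matrix (Fin D) (Fin D) ℂ) {N : ℕ}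
    (m : Fin N → Fin d) : ℂ :=
  ∑ l, ∑ r, conj (b l r) * entangledState A m l r

/-- Measuring the edge bond qudits collapses the prepared state onto definite boundary conditions:
the outcome given by any unit vector `b` yields the MPS with boundary matrix `bᴴ`, with a
probability that tends to `1 / D²` as the number of sites grows. -/
def EdgeMeasurement (A : Fin d → Matrix (Fin D) (Fin D) ℂ) : Prop :=
  ∀ b : Matrix (Fin D) (Fin D) ℂ, ∑ l, ∑ r, ‖b l r‖ ^ 2 = 1 →
    (∀ (N : ℕ) (m : Fin N → Fin d),
      edgeProjected A b m = ((1 / √(D : ℝ) : ℝ) : ℂ) * state A bᴴ m) ∧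
    Tendsto (fun N : ℕ => ∑ m : Fin N → Fin d, ‖edgeProjected A b m‖ ^ 2) atTop
      (𝓝 (1 / (D : ℝ) ^ 2))

end MPS

end

/-!
The symmetry on the virtual level comes from the fundamental theorem of matrix product states.
Write `B = U A` for the tensor rotated by one `U g`. The span of the pairs of corresponding words
`(A^w, B^w)` of length `k` is a power of one subspace of a product of two matrix algebras. Since `X
≠ 0` and the words span all matrices, the hypothesis on the states says that `B^w` is a function of
`A^w` (`snd_eq_zero_of_mem_pairSpan_pow`), so long words define a bijection of the full matrix
algebra. Up to a scalar it is an automorphism, hence inner, and `B = λ S⁻¹ A S`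
(`exists_eq_smul_conj`). As both tensors are left-canonical, `(S Sᴴ)⁻¹` is an eigenvector of the
dual transfer map, and a Perron-Frobenius argument makes `S` unitary up to a scalar and `|λ| = 1`
(`exists_unitary_gauge`). The stabiliser of a normal tensor is trivial, so that `V` is projective
and the phases are multiplicative (`ActsVirtually.mul_eq`).

For irreducible `V`, Schur orthogonality is the POVM condition (`IsProjectiveRep.isPOVM`), and `h =
g⁻¹` corrects the defect `g` because `V g⁻¹` is the adjoint of `V g` up to a phase. In the
protocol, every fusion outcome inserts a multiple of some `V g` on its bond (`fusionLayer_mulVec`).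
By covariance each `V g` is `Pushable`: an on-site unitary moves it through a site to the left.
Pushable unitaries are closed under products, so all defects can be collected on the left edge and
undone there (`exists_correction`). Locality is checked by giving the cells of each layer
explicitly.

For the edge measurement, `∑ A^m A^{m†}` commutes with `V`, so it is `1` by Schur's lemma and the
tensor is also right-canonical. The transfer map then contracts the Frobenius norm, and the loss is
a sum of squares of twisted commutators (`frobeniusSq_sub_frobeniusSq_sum`); normality makes the
contraction strict on traceless matrices, whence convergence to the completely depolarising map
(`tendsto_transfer_pow`) and the limit `1 / D²`.
-/

noncomputable section

namespace MPS

variable {D d : ℕ}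

/-! ### Words and their spans -/

theorem eq_smul_one_of_commute {W : Matrix (Fin D) (Fin D) ℂ} (hW : ∀ M, W * M = M * W) :
    ∃ c : ℂ, W = c • 1 := by
  obtain ⟨c, hc⟩ := Matrix.mem_range_scalar_iff_commute_single'.mpr
    fun i j => (hW (Matrix.single i j 1)).symm
  exact ⟨c, by rw [← hc, Matrix.scalar_apply, Matrix.smul_one_eq_diagonal]⟩

theorem word_succ (A : Fin d → Matrix (Fin D) (Fin D) ℂ) {N : ℕ} (m : Fin (N + 1) → Fin d) :
    word A m = A (m 0) * word A (Fin.tail m) := by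
  simp [word, List.ofFn_succ, Fin.tail]

theorem span_range_word (A : Fin d → Matrix (Fin D) (Fin D) ℂ) (N : ℕ) :
    Submodule.span ℂ (Set.range fun m : Fin N → Fin d => word A m)
      = Submodule.span ℂ (Set.range A) ^ N := by
  rw [Submodule.span_pow]
  congr 1
  ext M
  rw [Set.mem_pow]
  constructor
  · rintro ⟨m, rfl⟩
    exact ⟨fun i => ⟨A (m i), m i, rfl⟩, rfl⟩
  · rintro ⟨f, rfl⟩
    choose m hm using fun i => (f i).2
    exact ⟨m, by simp [word, hm]⟩

theorem IsNormal.exists_pow_eq_top {A : Fin d → Matrix (Fin D) (Fin D) ℂ} (h : IsNormal A) :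
    ∃ L : ℕ, 1 ≤ L ∧ Submodule.span ℂ (Set.range A) ^ L = ⊤ := by
  obtain ⟨L, hL, h⟩ := h
  exact ⟨L, hL, by rw [← span_range_word, h]⟩

/-- The tensor obtained from `A` by the action of the matrix `O` on the physical index. -/
def act (O : Matrix (Fin d) (Fin d) ℂ) (A : Fin d → Matrix (Fin D) (Fin D) ℂ) :
    Fin d → Matrix (Fin D) (Fin D) ℂ :=
  fun m => ∑ n, O m n • A n

theorem act_act (O P : Matrix (Fin d) (Fin d) ℂ) (A : Fin d → Matrix (Fin D) (Fin D) ℂ) :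
    act O (act P A) = act (O * P) A := by
  funext m
  simp only [act, Matrix.mul_apply, Finset.sum_smul, Finset.smul_sum, smul_smul]
  exact Finset.sum_comm

@[simp]
theorem act_one (A : Fin d → Matrix (Fin D) (Fin D) ℂ) : act 1 A = A := by
  funext m
  simp [act, Matrix.one_apply]

theorem span_range_act (O : Matrix.unitaryGroup (Fin d) ℂ)
    (A : Fin d → Matrix (Fin D) (Fin D) ℂ) :
    Submodule.span ℂ (Set.range (act (O : Matrix (Fin d) (Fin d) ℂ) A))
      = Submodule.span ℂ (Set.range A) := by
  have key : ∀ (P : Matrix (Fin d) (Fin d) ℂ) (A : Fin d → Matrix (Fin D) (Fin D) ℂ),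
      Submodule.span ℂ (Set.range (act P A)) ≤ Submodule.span ℂ (Set.range A) := by
    intro P A
    rw [Submodule.span_le]
    rintro _ ⟨m, rfl⟩
    exact Submodule.sum_mem _ fun n _ =>
      Submodule.smul_mem _ _ (Submodule.subset_span ⟨n, rfl⟩)
  refine le_antisymm (key _ _) ?_
  conv_lhs => rw [← act_one A, ← Matrix.UnitaryGroup.star_mul_self O, ← act_act]
  exact key _ _

/-- A unitary on the physical index mixes Kraus operators, hence preserves every sum of the form
`∑ A^m Y A^{m†}` or `∑ A^{m†} Y A^m`. -/
theorem sum_act (O : Matrix.unitaryGroup (Fin d) ℂ) (A : Fin d → Matrix (Fin D) (Fin D) ℂ)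
    (f : Matrix (Fin D) (Fin D) ℂ →ₗ⋆[ℂ] Matrix (Fin D) (Fin D) ℂ →ₗ[ℂ]
      Matrix (Fin D) (Fin D) ℂ) :
    ∑ m, f (act (O : Matrix (Fin d) (Fin d) ℂ) A m) (act (O : Matrix (Fin d) (Fin d) ℂ) A m)
      = ∑ m, f (A m) (A m) := by
  have h : ∀ n k, ∑ m, conj ((O : Matrix (Fin d) (Fin d) ℂ) m n)
      * (O : Matrix (Fin d) (Fin d) ℂ) m k = if n = k then 1 else 0 := by
    intro n k
    have := congrFun (congrFun (Matrix.UnitaryGroup.star_mul_self O) n) k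
    simpa [Matrix.mul_apply, Matrix.star_apply, Matrix.one_apply] using this
  simp only [act, map_sum, LinearMap.sum_apply, map_smul, LinearMap.map_smulₛₗ,
    LinearMap.smul_apply, Finset.smul_sum, smul_smul]
  calc _ = ∑ n, ∑ k, (∑ m, conj ((O : Matrix (Fin d) (Fin d) ℂ) m n)
            * (O : Matrix (Fin d) (Fin d) ℂ) m k) • f (A n) (A k) := by
        simp only [Finset.sum_smul]
        rw [Finset.sum_comm]
        conv_rhs => rw [Finset.sum_comm]
        refine Finset.sum_congr rfl fun k _ => ?_
        rw [Finset.sum_comm]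
        refine Finset.sum_congr rfl fun n _ => Finset.sum_congr rfl fun m _ => ?_
        rw [mul_comm]
    _ = _ := by simp [h]

theorem LeftCanonical.act {A : Fin d → Matrix (Fin D) (Fin D) ℂ} (h : LeftCanonical A)
    (O : Matrix.unitaryGroup (Fin d) ℂ) :
    LeftCanonical (MPS.act (O : Matrix (Fin d) (Fin d) ℂ) A) := by
  rw [LeftCanonical, ← h]
  exact sum_act O A (LinearMap.mk₂'ₛₗ (starRingEnd ℂ) (RingHom.id ℂ) (fun X Y => Xᴴ * Y)
    (by intros; simp [add_mul]) (by intros; simp) (by intros; simp [mul_add]) (by intros; simp))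

theorem sum_prod_smul_word {N : ℕ} (O : Matrix (Fin d) (Fin d) ℂ)
    (A : Fin d → Matrix (Fin D) (Fin D) ℂ) (m : Fin N → Fin d) :
    ∑ n : Fin N → Fin d, (∏ i, O (m i) (n i)) • word A n = word (act O A) m := by
  induction N with
  | zero => simp [word]
  | succ N ih =>
    rw [word_succ, ← ih (Fin.tail m), ← (Fin.consEquiv fun _ => Fin d).sum_comp,
      Fintype.sum_prod_type, act, Finset.sum_mul]
    refine Finset.sum_congr rfl fun a _ => ?_
    rw [Finset.mul_sum]
    refine Finset.sum_congr rfl fun n _ => ?_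
    simp [word_succ, Fin.prod_univ_succ, Fin.consEquiv, Fin.tail, smul_smul, mul_comm]

/-! ### Two tensors generating the same states -/

/-- The span of the pairs of corresponding letters of two tensors. Its `k`-th power is spanned by
the pairs of corresponding words of length `k`. -/
def pairSpan (A B : Fin d → Matrix (Fin D) (Fin D) ℂ) :
    Submodule ℂ (Matrix (Fin D) (Fin D) ℂ × Matrix (Fin D) (Fin D) ℂ) :=
  Submodule.span ℂ (Set.range fun m => (A m, B m))

theorem map_fst_pairSpan_pow (A B : Fin d → Matrix (Fin D) (Fin D) ℂ) (k : ℕ) :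
    (pairSpan A B ^ k).map (AlgHom.fst ℂ _ _).toLinearMap
      = Submodule.span ℂ (Set.range A) ^ k := by
  rw [Submodule.map_pow, pairSpan, Submodule.map_span, ← Set.range_comp]
  rfl

theorem map_snd_pairSpan_pow (A B : Fin d → Matrix (Fin D) (Fin D) ℂ) (k : ℕ) :
    (pairSpan A B ^ k).map (AlgHom.snd ℂ _ _).toLinearMap
      = Submodule.span ℂ (Set.range B) ^ k := by
  rw [Submodule.map_pow, pairSpan, Submodule.map_span, ← Set.range_comp]
  rfl

theorem trace_eq_of_mem_pairSpan_pow {A B : Fin d → Matrix (Fin D) (Fin D) ℂ}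
    {X X' : Matrix (Fin D) (Fin D) ℂ} {N : ℕ}
    (h : ∀ m : Fin N → Fin d, state B X m = state A X' m)
    {p : Matrix (Fin D) (Fin D) ℂ × Matrix (Fin D) (Fin D) ℂ} (hp : p ∈ pairSpan A B ^ N) :
    (p.2 * X).trace = (p.1 * X').trace := by
  rw [pairSpan, Submodule.span_pow] at hp
  induction hp using Submodule.span_induction with
  | mem p hp =>
    obtain ⟨f, rfl⟩ := Set.mem_pow.mp hp
    choose m hm using fun i => (f i).2
    have h1 : (List.ofFn fun i => (f i : Matrix (Fin D) (Fin D) ℂ × Matrix (Fin D) (Fin D) ℂ)).prod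
        = (word A m, word B m) := by
      simp only [← hm]
      apply Prod.ext
      · rw [← MonoidHom.coe_fst, map_list_prod, List.map_ofFn]; rfl
      · rw [← MonoidHom.coe_snd, map_list_prod, List.map_ofFn]; rfl
    rw [h1]
    exact h m
  | zero => simp
  | add p q _ _ hp hq => simp [add_mul, hp, hq]
  | smul c p _ hp => simp [hp]

/-- If the words of `B` with boundary `X ≠ 0` give states of the tensor `A`, then a word of `B` is
determined by the corresponding word of `A`. -/
theorem snd_eq_zero_of_mem_pairSpan_pow {A B : Fin d → Matrix (Fin D) (Fin D) ℂ}
    {X : Matrix (Fin D) (Fin D) ℂ} (hX : X ≠ 0)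
    (h : ∀ N : ℕ, ∃ X', ∀ m : Fin N → Fin d, state B X m = state A X' m) {L : ℕ}
    (hB : Submodule.span ℂ (Set.range B) ^ L = ⊤) {k : ℕ} {Y : Matrix (Fin D) (Fin D) ℂ}
    (hY : (0, Y) ∈ pairSpan A B ^ k) : Y = 0 := by
  have hsurj : ∀ Q, ∃ P, (P, Q) ∈ pairSpan A B ^ L := by
    intro Q
    have : Q ∈ (pairSpan A B ^ L).map (AlgHom.snd ℂ _ _).toLinearMap := by
      rw [map_snd_pairSpan_pow, hB]; trivial
    obtain ⟨⟨P, _⟩, hp, rfl⟩ := this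
    exact ⟨P, hp⟩
  have htr : ∀ Q₁ Q₂ : Matrix (Fin D) (Fin D) ℂ, (Q₁ * Y * Q₂ * X).trace = 0 := by
    intro Q₁ Q₂
    obtain ⟨P₁, h₁⟩ := hsurj Q₁
    obtain ⟨P₂, h₂⟩ := hsurj Q₂
    obtain ⟨X', hX'⟩ := h (L + k + L)
    have hmem : ((P₁, Q₁) * (0, Y) * (P₂, Q₂) :
        Matrix (Fin D) (Fin D) ℂ × Matrix (Fin D) (Fin D) ℂ) ∈ pairSpan A B ^ (L + k + L) := by
      rw [pow_add, pow_add]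
      exact Submodule.mul_mem_mul (Submodule.mul_mem_mul h₁ hY) h₂
    simpa using trace_eq_of_mem_pairSpan_pow hX' hmem
  -- matrix units isolate the product `Y i j * X k l`
  obtain ⟨k', l', hkl⟩ : ∃ k l, X k l ≠ 0 := by
    by_contra! hc
    exact hX (by ext i j; simp [hc])
  ext i j
  have := htr (Matrix.single l' i 1) (Matrix.single j k' 1)
  rw [Matrix.mul_assoc, Matrix.mul_assoc, Matrix.trace_mul_comm] at this
  simp only [Matrix.mul_assoc] at this
  have h2 : (Y * (Matrix.single j k' (1:ℂ) * (X * Matrix.single l' i 1))).trace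
      = Y i j * X k' l' := by
    rw [Matrix.trace_mul_comm, Matrix.mul_assoc, Matrix.mul_assoc, Matrix.trace_mul_comm]
    simp [Matrix.mul_assoc, Matrix.trace, Matrix.mul_apply, Matrix.single_apply, Finset.sum_ite_eq,
      ite_and, mul_comm]
  rw [h2] at this
  simpa [hkl] using this

/-- Automorphisms of a full matrix algebra are inner. -/
theorem exists_eq_conj (f : Matrix (Fin D) (Fin D) ℂ ≃ₐ[ℂ] Matrix (Fin D) (Fin D) ℂ) :
    ∃ S : Matrix (Fin D) (Fin D) ℂ, IsUnit S ∧ ∀ M, f M = S⁻¹ * M * S := by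
  obtain ⟨T, hT⟩ := ((Matrix.toLinAlgEquiv' (R := ℂ) (n := Fin D)).symm.trans
    (f.trans Matrix.toLinAlgEquiv')).eq_linearEquivConjAlgEquiv
  have h1 : LinearMap.toMatrix' T.toLinearMap * LinearMap.toMatrix' T.symm.toLinearMap = 1 := by
    rw [← LinearMap.toMatrix'_comp]; simp
  have hinv : (LinearMap.toMatrix' T.symm.toLinearMap)⁻¹ = LinearMap.toMatrix' T.toLinearMap :=
    Matrix.inv_eq_left_inv h1
  refine ⟨LinearMap.toMatrix' T.symm.toLinearMap,
    (Matrix.isUnit_iff_isUnit_det _).2 (Matrix.isUnit_det_of_left_inverse h1), fun M => ?_⟩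
  have h2 : Matrix.toLin' (f M) = T.toLinearMap ∘ₗ Matrix.toLin' M ∘ₗ T.symm.toLinearMap := by
    have h3 := DFunLike.congr_fun hT (Matrix.toLin' M)
    have h4 : (Matrix.toLinAlgEquiv'.symm (Matrix.toLin' M) : Matrix (Fin D) (Fin D) ℂ) = M :=
      LinearMap.toMatrix'_toLin' M
    simp only [AlgEquiv.trans_apply, h4] at h3
    exact h3
  apply Matrix.toLin'.injective
  rw [h2, hinv, Matrix.mul_assoc, Matrix.toLin'_mul, Matrix.toLin'_mul]
  simp

open scoped ComplexOrder

theorem span_pow_succ_eq_top {A : Fin d → Matrix (Fin D) (Fin D) ℂ} {L : ℕ} (hL : 1 ≤ L)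
    (hA : Submodule.span ℂ (Set.range A) ^ L = ⊤) :
    Submodule.span ℂ (Set.range A) ^ (L + 1) = ⊤ := by
  set S := Submodule.span ℂ (Set.range A)
  have htop : (⊤ : Submodule ℂ (Matrix (Fin D) (Fin D) ℂ)) ≤ ⊤ * ⊤ := fun M _ => by
    simpa using Submodule.mul_mem_mul (Submodule.mem_top (x := M))
      (Submodule.mem_top (x := (1 : Matrix (Fin D) (Fin D) ℂ)))
  obtain ⟨k, rfl⟩ := Nat.exists_eq_add_of_le hL
  rw [eq_top_iff]
  calc ⊤ ≤ S ^ (1 + k) * ⊤ := by rw [hA]; exact htop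
    _ = S * (S ^ k * ⊤) := by rw [pow_add, pow_one, mul_assoc]
    _ ≤ S * ⊤ := mul_le_mul' le_rfl le_top
    _ = S ^ (1 + k + 1) := by rw [pow_succ' S (1 + k), hA]

/-- The algebraic part of the fundamental theorem: for `k ≥ L` the `k`-th power of the span of
pairs is the graph of a linear bijection of the full matrix algebra, which is a scalar times an
automorphism; the automorphism is inner and relates the two tensors. -/
theorem exists_eq_smul_conj {A B : Fin d → Matrix (Fin D) (Fin D) ℂ} [NeZero D]
    {X : Matrix (Fin D) (Fin D) ℂ} (hX : X ≠ 0)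
    (h : ∀ N : ℕ, ∃ X', ∀ m : Fin N → Fin d, state B X m = state A X' m) {L : ℕ} (hL : 1 ≤ L)
    (hA : Submodule.span ℂ (Set.range A) ^ L = ⊤)
    (hB : Submodule.span ℂ (Set.range B) ^ L = ⊤) :
    ∃ (lam : ℂ) (S : Matrix (Fin D) (Fin D) ℂ), IsUnit S ∧
      ∀ m, B m = lam • (S⁻¹ * A m * S) := by
  have hzero : ∀ {k Y}, (0, Y) ∈ pairSpan A B ^ k → Y = 0 :=
    fun hY => snd_eq_zero_of_mem_pairSpan_pow hX h hB hY
  have huniq : ∀ {k P Q Q'}, (P, Q) ∈ pairSpan A B ^ k → (P, Q') ∈ pairSpan A B ^ k →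
      Q = Q' := fun {k P Q Q'} h1 h2 => by
    have := Submodule.sub_mem _ h1 h2
    rw [Prod.mk_sub_mk, sub_self] at this
    exact sub_eq_zero.mp (hzero this)
  have hex : ∀ {k}, Submodule.span ℂ (Set.range A) ^ k = ⊤ → ∀ P, ∃ Q,
      (P, Q) ∈ pairSpan A B ^ k := by
    intro k hk P
    have : P ∈ (pairSpan A B ^ k).map (AlgHom.fst ℂ _ _).toLinearMap := by
      rw [map_fst_pairSpan_pow, hk]; trivial
    obtain ⟨⟨_, Q⟩, hp, rfl⟩ := this
    exact ⟨Q, hp⟩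
  have hmul : ∀ {k l P Q P' Q'}, (P, Q) ∈ pairSpan A B ^ k → (P', Q') ∈ pairSpan A B ^ l →
      (P * P', Q * Q') ∈ pairSpan A B ^ (k + l) := fun h1 h2 => by
    rw [pow_add]
    exact Submodule.mul_mem_mul h1 h2
  choose T hT using hex hA
  have hTsurj : Function.Surjective T := by
    intro Q
    have : Q ∈ (pairSpan A B ^ L).map (AlgHom.snd ℂ _ _).toLinearMap := by
      rw [map_snd_pairSpan_pow, hB]; trivial
    obtain ⟨⟨P, _⟩, hp, rfl⟩ := this
    exact ⟨P, huniq (hT P) hp⟩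
  have hTmul : ∀ M N, T M * T N = T 1 * T (M * N) := fun M N =>
    huniq (hmul (hT M) (hT N)) (by simpa using hmul (hT 1) (hT (M * N)))
  have hcomm : ∀ {k Q}, (1, Q) ∈ pairSpan A B ^ k → ∃ q : ℂ, Q = q • 1 := by
    intro k Q hQ
    refine eq_smul_one_of_commute fun M => ?_
    obtain ⟨N, rfl⟩ := hTsurj M
    refine huniq (P := N) (by simpa using hmul hQ (hT N)) ?_
    rw [add_comm]
    simpa using hmul (hT N) hQ
  obtain ⟨μ, hμ⟩ := hcomm (hT 1)
  have hμ0 : μ ≠ 0 := by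
    rintro rfl
    obtain ⟨N, hN⟩ := hTsurj 1
    have := hTmul N N
    rw [hμ, hN] at this
    simp at this
  obtain ⟨Q, hQ⟩ := hex (span_pow_succ_eq_top hL hA) 1
  obtain ⟨q, rfl⟩ := hcomm hQ
  have hTadd : ∀ M N, T (M + N) = T M + T N := fun M N =>
    huniq (hT _) (Submodule.add_mem _ (hT M) (hT N))
  have hTsmul : ∀ (c : ℂ) M, T (c • M) = c • T M := fun c M =>
    huniq (hT _) (Submodule.smul_mem _ c (hT M))
  let φ : Matrix (Fin D) (Fin D) ℂ →ₐ[ℂ] Matrix (Fin D) (Fin D) ℂ :=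
    AlgHom.ofLinearMap
      { toFun := fun M => μ⁻¹ • T M
        map_add' := fun M N => by rw [hTadd, smul_add]
        map_smul' := fun c M => by rw [hTsmul, smul_comm]; rfl }
      (by simp [hμ, smul_smul, hμ0])
      (fun M N => by
        have := hTmul M N
        rw [hμ, smul_mul_assoc, one_mul] at this
        simp [this, smul_smul, hμ0])
  have hφ : ∀ M, φ M = μ⁻¹ • T M := fun M => rfl
  have hφsurj : Function.Surjective φ := fun M => by
    obtain ⟨N, hN⟩ := hTsurj (μ • M)
    exact ⟨N, by simp [hφ, hN, smul_smul, hμ0]⟩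
  have hφbij : Function.Bijective φ :=
    ⟨(LinearMap.injective_iff_surjective (f := φ.toLinearMap)).mpr hφsurj, hφsurj⟩
  obtain ⟨S, hS, hconj⟩ := exists_eq_conj (AlgEquiv.ofBijective φ hφbij)
  refine ⟨μ⁻¹ * q, S, hS, fun m => ?_⟩
  -- compare the two ways to reach the letter `m` inside words of length `2 L + 1`
  have hletter : (A m, B m) ∈ pairSpan A B ^ 1 := by
    rw [pow_one]; exact Submodule.subset_span ⟨m, rfl⟩
  have e1 := hmul (hmul (hT 1) hletter) (hT 1)
  have e2 := hmul hQ (hT (A m))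
  have e3 := huniq (by simpa using e1) (by simpa using e2)
  have e4 : T (A m) = μ • (S⁻¹ * A m * S) := by
    have := hconj (A m)
    rw [← this, AlgEquiv.coe_ofBijective, hφ, smul_smul, mul_inv_cancel₀ hμ0, one_smul]
  rw [hμ, e4] at e3
  simp only [smul_mul_assoc, mul_smul_comm, one_mul, mul_one, smul_smul] at e3
  have e5 := congrArg (fun M => (μ⁻¹ * μ⁻¹) • M) e3
  simp only [smul_smul] at e5
  rw [show μ⁻¹ * μ⁻¹ * (μ * μ) = 1 by field_simp, one_smul] at e5
  rw [e5]
  congr 1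
  field_simp

/-! ### Perron-Frobenius arguments and unitarity of the gauge -/

/-- The least eigenvalue of a Hermitian matrix. -/
theorem exists_least_eigenvalue [NeZero D] {H : Matrix (Fin D) (Fin D) ℂ} (hH : H.IsHermitian) :
    ∃ (q : ℝ) (v : Fin D → ℂ), v ≠ 0 ∧ H *ᵥ v = (q : ℂ) • v ∧ (H - (q : ℂ) • 1).PosSemidef := by
  obtain ⟨i, hi⟩ := Finite.exists_min hH.eigenvalues
  refine ⟨hH.eigenvalues i, hH.eigenvectorBasis i, ?_, hH.mulVec_eigenvectorBasis i, ?_⟩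
  · intro h0
    have := hH.eigenvectorBasis.orthonormal.ne_zero i
    exact this (by ext j; exact congrFun h0 j)
  · have h1 : H - ((hH.eigenvalues i : ℝ) : ℂ) • 1
        = (hH.eigenvectorUnitary : Matrix (Fin D) (Fin D) ℂ)
          * diagonal (fun j => ((hH.eigenvalues j - hH.eigenvalues i : ℝ) : ℂ))
          * (hH.eigenvectorUnitary : Matrix (Fin D) (Fin D) ℂ)ᴴ := by
      conv_lhs => lhs; rw [hH.spectral_theorem]
      have hu : (hH.eigenvectorUnitary : Matrix (Fin D) (Fin D) ℂ)
          * (hH.eigenvectorUnitary : Matrix (Fin D) (Fin D) ℂ)ᴴ = 1 :=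
        Unitary.coe_mul_star_self _
      rw [Unitary.conjStarAlgAut_apply,
        show (fun j => ((hH.eigenvalues j - hH.eigenvalues i : ℝ) : ℂ))
          = fun j => (RCLike.ofReal ∘ hH.eigenvalues) j - ((hH.eigenvalues i : ℝ) : ℂ) by
            funext j; simp, ← Matrix.diagonal_sub, mul_sub, sub_mul]
      congr 1
      rw [← Matrix.smul_one_eq_diagonal, mul_smul_comm, mul_one, smul_mul_assoc, hu]
    rw [h1]
    refine Matrix.PosSemidef.mul_mul_conjTranspose_same (Matrix.PosSemidef.diagonal ?_) _
    intro j
    simpa [Complex.zero_le_real] using hi j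

/-- The dual transfer map of a tensor, `Y ↦ ∑ A^{m†} Y A^m`. -/
def transfer (A : Fin d → Matrix (Fin D) (Fin D) ℂ) :
    Matrix (Fin D) (Fin D) ℂ →ₗ[ℂ] Matrix (Fin D) (Fin D) ℂ :=
  ∑ m, (LinearMap.mulLeft ℂ (A m)ᴴ) ∘ₗ (LinearMap.mulRight ℂ (A m))

theorem transfer_apply (A : Fin d → Matrix (Fin D) (Fin D) ℂ) (Y : Matrix (Fin D) (Fin D) ℂ) :
    transfer A Y = ∑ m, (A m)ᴴ * Y * A m := by
  simp [transfer, LinearMap.sum_apply, Matrix.mul_assoc]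

theorem LeftCanonical.transfer_one {A : Fin d → Matrix (Fin D) (Fin D) ℂ} (h : LeftCanonical A) :
    transfer A 1 = 1 := by
  simpa [transfer_apply, LeftCanonical] using h

theorem star_dotProduct_transfer_mulVec (A : Fin d → Matrix (Fin D) (Fin D) ℂ)
    (R : Matrix (Fin D) (Fin D) ℂ) (v : Fin D → ℂ) :
    star v ⬝ᵥ (transfer A R *ᵥ v) = ∑ m, star (A m *ᵥ v) ⬝ᵥ (R *ᵥ (A m *ᵥ v)) := by
  rw [transfer_apply, Matrix.sum_mulVec, dotProduct_sum]
  refine Finset.sum_congr rfl fun m _ => ?_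
  rw [star_mulVec, ← Matrix.mulVec_mulVec, ← Matrix.mulVec_mulVec, Matrix.dotProduct_mulVec]

/-- A Hermitian eigenvector of the dual transfer map, with real eigenvalue `t`, has
`t q ≥ q` for its least eigenvalue `q`. -/
theorem le_mul_least_eigenvalue {A : Fin d → Matrix (Fin D) (Fin D) ℂ} (hcan : LeftCanonical A)
    {H : Matrix (Fin D) (Fin D) ℂ} {t q : ℝ} (ht : transfer A H = (t : ℂ) • H) {v : Fin D → ℂ}
    (hv : v ≠ 0) (hq : H *ᵥ v = (q : ℂ) • v) (hpos : (H - (q : ℂ) • 1).PosSemidef) :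
    q ≤ t * q := by
  have h1 := star_dotProduct_transfer_mulVec A (H - (q : ℂ) • 1) v
  have h2 : 0 ≤ star v ⬝ᵥ (transfer A (H - (q : ℂ) • 1) *ᵥ v) := by
    rw [h1]
    exact Finset.sum_nonneg fun m _ => hpos.dotProduct_mulVec_nonneg _
  rw [map_sub, map_smul, hcan.transfer_one, ht, sub_mulVec, smul_mulVec, smul_mulVec, hq,
    one_mulVec, smul_smul, ← sub_smul, dotProduct_smul, smul_eq_mul] at h2
  have h3 : 0 < star v ⬝ᵥ v := dotProduct_star_self_pos_iff.mpr hv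
  have h4 : (0 : ℂ) ≤ (t * q - q : ℝ) := by
    have := le_of_mul_le_mul_right ((zero_mul (star v ⬝ᵥ v)).trans_le h2) h3
    simpa using this
  have := Complex.zero_le_real.mp h4
  linarith

/-- Fixed points of the dual transfer map are scalar: subtracting the least eigenvalue leaves a
positive fixed point, whose kernel is nonzero and invariant under all letters. -/
theorem LeftCanonical.eq_smul_one_of_transfer_eq [NeZero D] {A : Fin d → Matrix (Fin D) (Fin D) ℂ}
    (hcan : LeftCanonical A) (hnormal : IsNormal A) {H : Matrix (Fin D) (Fin D) ℂ}
    (hH : H.IsHermitian) (hfix : transfer A H = H) : ∃ q : ℝ, H = (q : ℂ) • 1 := by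
  obtain ⟨q, v, hv, hq, hpos⟩ := exists_least_eigenvalue hH
  refine ⟨q, ?_⟩
  set R := H - (q : ℂ) • 1 with hR
  have hRfix : transfer A R = R := by rw [hR, map_sub, map_smul, hcan.transfer_one, hfix]
  have hinv : ∀ m w, R *ᵥ w = 0 → R *ᵥ (A m *ᵥ w) = 0 := by
    intro m w hw
    have h1 := star_dotProduct_transfer_mulVec A R w
    rw [hRfix, hw, dotProduct_zero] at h1
    have h2 := (Finset.sum_eq_zero_iff_of_nonneg
      fun m _ => hpos.dotProduct_mulVec_nonneg (A m *ᵥ w)).mp h1.symm m (Finset.mem_univ _)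
    exact (hpos.dotProduct_mulVec_zero_iff _).mp h2
  obtain ⟨L, -, hL⟩ := hnormal.exists_pow_eq_top
  have hall : ∀ (k : ℕ), ∀ M ∈ Submodule.span ℂ (Set.range A) ^ k, R *ᵥ (M *ᵥ v) = 0 := by
    intro k M hM
    refine Submodule.pow_induction_on_left (C := fun M => R *ᵥ (M *ᵥ v) = 0)
      (Submodule.span ℂ (Set.range A)) ?_ ?_ ?_ hM
    · intro r
      rw [Algebra.algebraMap_eq_smul_one, smul_mulVec, one_mulVec, mulVec_smul, hR, sub_mulVec, hq]
      simp [smul_mulVec]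
    · intro x y hx hy
      rw [add_mulVec, mulVec_add, hx, hy, add_zero]
    · intro M hM N hN
      rw [← Matrix.mulVec_mulVec]
      induction hM using Submodule.span_induction with
      | mem M hM => obtain ⟨m, rfl⟩ := hM; exact hinv m _ hN
      | zero => simp
      | add x y _ _ hx hy => rw [add_mulVec, mulVec_add, hx, hy, add_zero]
      | smul c x _ hx => rw [smul_mulVec, mulVec_smul, hx, smul_zero]
  obtain ⟨j, hj⟩ := Function.ne_iff.mp hv
  have hR0 : R = 0 := by
    ext i k
    have := hall L (Matrix.single k j (v j)⁻¹) (by rw [hL]; trivial)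
    have h2 : Matrix.single k j (v j)⁻¹ *ᵥ v = Pi.single k 1 := by
      have : v j ≠ 0 := hj
      rw [Matrix.single_mulVec]
      simp [this]
      rfl
    rw [h2, Matrix.mulVec_single_one] at this
    exact congrFun this i
  exact sub_eq_zero.mp hR0

/-- A gauge transformation between two left-canonical tensors, one of them normal, is unitary up to
a scalar. -/
theorem exists_unitary_gauge [NeZero D] {A B : Fin d → Matrix (Fin D) (Fin D) ℂ}
    (hA : LeftCanonical A) (hB : LeftCanonical B) (hnormal : IsNormal A) {lam : ℂ}
    {S : Matrix (Fin D) (Fin D) ℂ} (hS : IsUnit S) (h : ∀ m, B m = lam • (S⁻¹ * A m * S)) :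
    ∃ (V : Matrix.unitaryGroup (Fin D) ℂ) (c : Circle), ∀ m, B m
      = (c : ℂ) • ((V : Matrix (Fin D) (Fin D) ℂ)ᴴ * A m * (V : Matrix (Fin D) (Fin D) ℂ)) := by
  have hdet : IsUnit S.det := (Matrix.isUnit_iff_isUnit_det _).mp hS
  have hSi : S * S⁻¹ = 1 := Matrix.mul_nonsing_inv _ hdet
  have hiS : S⁻¹ * S = 1 := Matrix.nonsing_inv_mul _ hdet
  have hSi' : S⁻¹ᴴ * Sᴴ = 1 := by rw [← conjTranspose_mul, hSi, conjTranspose_one]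
  have hiS' : Sᴴ * S⁻¹ᴴ = 1 := by rw [← conjTranspose_mul, hiS, conjTranspose_one]
  set Q := S⁻¹ᴴ * S⁻¹ with hQ
  have hQpos : Q.PosDef := by
    refine Matrix.PosDef.conjTranspose_mul_self _ ?_
    exact Matrix.mulVec_injective_of_isUnit ((Matrix.isUnit_nonsing_inv_iff).mpr hS)
  have hQH : Q.IsHermitian := hQpos.isHermitian
  -- left-canonicity of `B`, conjugated by `S`, is an eigenvalue equation for `Q`
  have h1 : (lam * conj lam) • transfer A Q = Q := by
    have : Sᴴ * ((lam * conj lam) • transfer A Q) * S = 1 := by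
      rw [← hB, transfer_apply, mul_smul_comm, smul_mul_assoc, Finset.mul_sum, Finset.sum_mul,
        Finset.smul_sum]
      refine Finset.sum_congr rfl fun m _ => ?_
      rw [h m, conjTranspose_smul, smul_mul_smul_comm, hQ]
      simp only [conjTranspose_mul, Matrix.mul_assoc, mul_comm lam]
      rfl
    calc _ = S⁻¹ᴴ * (Sᴴ * ((lam * conj lam) • transfer A Q) * S) * S⁻¹ := by
          rw [Matrix.mul_assoc Sᴴ, ← Matrix.mul_assoc S⁻¹ᴴ, hSi', one_mul, Matrix.mul_assoc, hSi,
            mul_one]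
      _ = Q := by rw [this, mul_one]
  obtain ⟨q₁, v₁, hv₁, hq₁, hpos₁⟩ := exists_least_eigenvalue hQH
  have hval : ∀ (q : ℝ) (v : Fin D → ℂ), v ≠ 0 → Q *ᵥ v = (q : ℂ) • v → 0 < q := by
    intro q v hv hq
    have := hQpos.dotProduct_mulVec_pos hv
    rw [hq, dotProduct_smul, smul_eq_mul] at this
    have h3 : 0 < star v ⬝ᵥ v := dotProduct_star_self_pos_iff.mpr hv
    exact Complex.zero_lt_real.mp ((mul_pos_iff_of_pos_right h3).mp this)
  have hQ0 : Q ≠ 0 := fun h0 =>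
    lt_irrefl (0 : ℝ) (hval 0 v₁ hv₁ (by rw [h0]; simp))
  have hlam : lam ≠ 0 := by
    rintro rfl
    apply hQ0
    rw [← h1]; simp
  set t : ℝ := (Complex.normSq lam)⁻¹ with ht
  have hn0 : 0 < Complex.normSq lam := Complex.normSq_pos.mpr hlam
  have h2 : transfer A Q = (t : ℂ) • Q := by
    conv_rhs => rw [← h1]
    rw [smul_smul, Complex.mul_conj, ht, ← Complex.ofReal_mul, inv_mul_cancel₀ hn0.ne']
    simp
  obtain ⟨q₂, v₂, hv₂, hq₂, hpos₂⟩ := exists_least_eigenvalue hQH.neg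
  have hp₁ := hval q₁ v₁ hv₁ hq₁
  have hp₂ := hval (-q₂) v₂ hv₂ (by
    rw [neg_mulVec] at hq₂
    rw [← neg_neg (Q *ᵥ v₂), hq₂]; simp)
  -- the least eigenvalues of `Q` and of `-Q` give `1 ≤ t` and `t ≤ 1`
  have ht1 : t = 1 := by
    have a1 := le_mul_least_eigenvalue hA h2 hv₁ hq₁ hpos₁
    have a2 := le_mul_least_eigenvalue hA (by rw [map_neg, h2, smul_neg]) hv₂ hq₂ hpos₂
    apply le_antisymm
    · by_contra! hc; nlinarith
    · by_contra! hc; nlinarith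
  rw [ht1] at h2
  obtain ⟨q, hq⟩ := hA.eq_smul_one_of_transfer_eq hnormal hQH (by simpa using h2)
  have hq0 : 0 < q := hval q v₁ hv₁ (by rw [hq, smul_mulVec, one_mulVec])
  have hsq : ((√q : ℝ) : ℂ) * ((√q : ℝ) : ℂ) = (q : ℂ) := by
    rw [← Complex.ofReal_mul, Real.mul_self_sqrt hq0.le]
  have hVV : Sᴴ * ((q : ℂ) • 1) * S = 1 := by
    rw [← hq, hQ, ← Matrix.mul_assoc, hiS', one_mul, hiS]
  have hV : (((√q : ℝ) : ℂ) • S)ᴴ * (((√q : ℝ) : ℂ) • S) = 1 := by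
    rw [conjTranspose_smul, smul_mul_smul_comm, ← hVV]
    simp [hsq]
  have hVinv : S⁻¹ = (q : ℂ) • Sᴴ := by
    apply Matrix.inv_eq_left_inv
    rw [← hVV]; simp
  refine ⟨⟨((√q : ℝ) : ℂ) • S, Matrix.mem_unitaryGroup_iff'.mpr hV⟩, ⟨lam, ?_⟩, fun m => ?_⟩
  · refine mem_sphere_zero_iff_norm.mpr ?_
    have : ‖lam‖ ^ 2 = 1 := by
      rw [← Complex.normSq_eq_norm_sq]
      rw [ht] at ht1
      exact inv_eq_one.mp ht1
    exact (pow_eq_one_iff_of_nonneg (norm_nonneg _) two_ne_zero).mp this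
  · have hstar : star ((√q : ℝ) : ℂ) = ((√q : ℝ) : ℂ) := Complex.conj_ofReal _
    rw [h m, hVinv, ← hsq]
    simp only [conjTranspose_smul, hstar, smul_mul_assoc, mul_smul_comm, smul_smul]

/-- The virtual action of an on-site symmetry. -/
theorem exists_actsVirtually [NeZero D] {G : Type*} [Group G] [Fintype G]
    {A : Fin d → Matrix (Fin D) (Fin D) ℂ}
    (hcan : LeftCanonical A) (hnormal : IsNormal A) {X : Matrix (Fin D) (Fin D) ℂ} (hX : X ≠ 0)
    (U : G →* Matrix.unitaryGroup (Fin d) ℂ) (hsym : HasOnSiteSymmetry A X U) :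
    ∃ (V : G → Matrix.unitaryGroup (Fin D) ℂ) (c : G → Circle), ActsVirtually A U V c := by
  have key : ∀ g : G, ∃ (V : Matrix.unitaryGroup (Fin D) ℂ) (c : Circle), ∀ m,
      act (U g : Matrix (Fin d) (Fin d) ℂ) A m
      = (c : ℂ) • ((V : Matrix (Fin D) (Fin D) ℂ)ᴴ * A m * (V : Matrix (Fin D) (Fin D) ℂ)) := by
    intro g
    obtain ⟨L, hL, hA⟩ := hnormal.exists_pow_eq_top
    have h : ∀ N : ℕ, ∃ X', ∀ m : Fin N → Fin d,
        state (act (U g : Matrix (Fin d) (Fin d) ℂ) A) X m = state A X' m := by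
      intro N
      obtain ⟨X', hX'⟩ := hsym g N
      refine ⟨X', fun m => ?_⟩
      rw [← hX', state, ← sum_prod_smul_word, Finset.sum_mul, Matrix.trace_sum]
      simp [state]
    obtain ⟨lam, S, hS, hB⟩ := exists_eq_smul_conj hX h hL hA (by rw [span_range_act, hA])
    exact exists_unitary_gauge hcan (hcan.act _) hnormal hS hB
  choose V c h using key
  exact ⟨V, c, h⟩

variable {G : Type*}

/-! ### The virtual representation -/

theorem _root_.Matrix.UnitaryGroup.conjTranspose_mul_self {n : ℕ}
    (V : Matrix.unitaryGroup (Fin n) ℂ) :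
    (V : Matrix (Fin n) (Fin n) ℂ)ᴴ * (V : Matrix (Fin n) (Fin n) ℂ) = 1 :=
  Matrix.UnitaryGroup.star_mul_self V

theorem _root_.Matrix.UnitaryGroup.mul_conjTranspose_self {n : ℕ}
    (V : Matrix.unitaryGroup (Fin n) ℂ) :
    (V : Matrix (Fin n) (Fin n) ℂ) * (V : Matrix (Fin n) (Fin n) ℂ)ᴴ = 1 :=
  Unitary.coe_mul_star_self V

open Matrix.UnitaryGroup (conjTranspose_mul_self mul_conjTranspose_self)

/-- The stabiliser of a normal tensor under gauge transformations and rescalings is trivial. -/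
theorem IsNormal.eq_smul_one_of_twisted_commute [NeZero D] {A : Fin d → Matrix (Fin D) (Fin D) ℂ}
    (hcan : LeftCanonical A) (hnormal : IsNormal A) {W : Matrix (Fin D) (Fin D) ℂ} (hW : IsUnit W)
    {lam : ℂ} (h : ∀ m, lam • (A m * W) = W * A m) : lam = 1 ∧ ∃ ω : ℂ, W = ω • 1 := by
  obtain ⟨L, -, hL⟩ := hnormal.exists_pow_eq_top
  -- a span of words of length `L` contains `1`, which forces `lam ^ L = 1` and `W` central
  have hpow : ∀ k, ∀ M ∈ Submodule.span ℂ (Set.range A) ^ k, lam ^ k • (M * W) = W * M := by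
    intro k M hM
    induction hM using Submodule.pow_induction_on_left' with
    | algebraMap r => simp [Algebra.algebraMap_eq_smul_one]
    | add x y i hx hy ihx ihy => rw [add_mul, smul_add, ihx, ihy, mul_add]
    | mem_mul M hM i N hN ih =>
      have hM' : lam • (M * W) = W * M := by
        induction hM using Submodule.span_induction with
        | mem M hM => obtain ⟨m, rfl⟩ := hM; exact h m
        | zero => simp
        | add x y _ _ hx hy => rw [add_mul, smul_add, hx, hy, mul_add]
        | smul c x _ hx => rw [smul_mul_assoc, smul_comm, hx, mul_smul_comm]
      rw [← Matrix.mul_assoc, ← hM', Matrix.mul_assoc M, smul_mul_assoc, Matrix.mul_assoc M W, ← ih,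
        mul_smul_comm, smul_smul, pow_succ']
  have hW0 : W ≠ 0 := hW.ne_zero
  have hlamL : lam ^ L = 1 := by
    have := hpow L 1 (by rw [hL]; trivial)
    rw [one_mul, mul_one] at this
    exact smul_left_injective ℂ hW0 (this.trans (one_smul ℂ W).symm)
  obtain ⟨ω, rfl⟩ := eq_smul_one_of_commute (W := W) fun M => by
    rw [← hpow L M (by rw [hL]; trivial), hlamL, one_smul]
  refine ⟨?_, ω, rfl⟩
  have hω : ω ≠ 0 := by rintro rfl; exact hW0 (by simp)
  have hA : ∃ m, A m ≠ 0 := by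
    by_contra! hc
    have : (1 : Matrix (Fin D) (Fin D) ℂ) = 0 := by rw [← hcan]; simp [hc]
    exact one_ne_zero this
  obtain ⟨m, hm⟩ := hA
  have := h m
  rw [mul_smul_comm, smul_mul_assoc, mul_one, one_mul] at this
  exact smul_left_injective ℂ (smul_ne_zero hω hm) (this.trans (one_smul ℂ _).symm)

theorem act_smul_mul_mul (O : Matrix (Fin d) (Fin d) ℂ) (A : Fin d → Matrix (Fin D) (Fin D) ℂ)
    (t : ℂ) (P Q : Matrix (Fin D) (Fin D) ℂ) (m : Fin d) :
    act O (fun n => t • (P * A n * Q)) m = t • (P * act O A m * Q) := by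
  simp only [act, Finset.mul_sum, Finset.sum_mul, Finset.smul_sum]
  refine Finset.sum_congr rfl fun n _ => ?_
  rw [smul_comm, mul_smul_comm, smul_mul_assoc]

theorem ActsVirtually.act_eq [Group G] {A : Fin d → Matrix (Fin D) (Fin D) ℂ}
    {U : G →* Matrix.unitaryGroup (Fin d) ℂ} {V : G → Matrix.unitaryGroup (Fin D) ℂ}
    {c : G → Circle}
    (h : ActsVirtually A U V c) (g : G) (m : Fin d) :
    act (U g : Matrix (Fin d) (Fin d) ℂ) A m = (c g : ℂ) • ((V g : Matrix (Fin D) (Fin D) ℂ)ᴴ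
      * A m * (V g : Matrix (Fin D) (Fin D) ℂ)) :=
  h g m

/-- Both `V g V k` and `V (g k)` implement `U (g k)`, so they differ by a gauge in the stabiliser of
the tensor. -/
theorem ActsVirtually.mul_eq [Group G] [NeZero D] {A : Fin d → Matrix (Fin D) (Fin D) ℂ}
    (hcan : LeftCanonical A) (hnormal : IsNormal A)
    {U : G →* Matrix.unitaryGroup (Fin d) ℂ} {V : G → Matrix.unitaryGroup (Fin D) ℂ}
    {c : G → Circle}
    (h : ActsVirtually A U V c) (g k : G) :
    c (g * k) = c g * c k ∧ ∃ ω : Circle,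
      (V g : Matrix (Fin D) (Fin D) ℂ) * (V k : Matrix (Fin D) (Fin D) ℂ)
        = (ω : ℂ) • (V (g * k) : Matrix (Fin D) (Fin D) ℂ) := by
  set P := V g * V k with hP
  have h1 : ∀ m, ((c g * c k : Circle) : ℂ) • ((P : Matrix (Fin D) (Fin D) ℂ)ᴴ * A m
      * (P : Matrix (Fin D) (Fin D) ℂ))
      = (c (g * k) : ℂ) • ((V (g * k) : Matrix (Fin D) (Fin D) ℂ)ᴴ
      * A m * (V (g * k) : Matrix (Fin D) (Fin D) ℂ)) := by
    intro m
    rw [← h.act_eq, map_mul, Matrix.UnitaryGroup.mul_val (U g) (U k), ← act_act]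
    have : act (U k : Matrix (Fin d) (Fin d) ℂ) A = fun m => (c k : ℂ) •
        ((V k : Matrix (Fin D) (Fin D) ℂ)ᴴ * A m * (V k : Matrix (Fin D) (Fin D) ℂ)) :=
      funext (h.act_eq k)
    rw [this, act_smul_mul_mul, h.act_eq g]
    simp [hP, Matrix.mul_assoc, smul_smul, mul_comm]
  set Q := V (g * k)
  -- the gauge `W = V_g V_k V_{gk}†` commutes with the tensor up to a phase
  have h3 : ∀ m, (((c g * c k * (c (g * k))⁻¹ : Circle)) : ℂ) • (A m *
      ((P * Q⁻¹ : Matrix.unitaryGroup (Fin D) ℂ) : Matrix (Fin D) (Fin D) ℂ))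
      = ((P * Q⁻¹ : Matrix.unitaryGroup (Fin D) ℂ) : Matrix (Fin D) (Fin D) ℂ) * A m := by
    intro m
    have h4 := congrArg (fun M => ((c (g * k))⁻¹ : ℂ) • ((P : Matrix (Fin D) (Fin D) ℂ) * M
      * (Q : Matrix (Fin D) (Fin D) ℂ)ᴴ)) (h1 m)
    have hc0 : (c (g * k) : ℂ) ≠ 0 := Circle.coe_ne_zero _
    simp only [mul_smul_comm, smul_mul_assoc, smul_smul, inv_mul_cancel₀ hc0, one_smul] at h4
    have h5 : (P : Matrix (Fin D) (Fin D) ℂ) * ((Q : Matrix (Fin D) (Fin D) ℂ)ᴴ * A m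
        * (Q : Matrix (Fin D) (Fin D) ℂ)) * (Q : Matrix (Fin D) (Fin D) ℂ)ᴴ
        = (P : Matrix (Fin D) (Fin D) ℂ) * (Q : Matrix (Fin D) (Fin D) ℂ)ᴴ * A m := by
      simp only [Matrix.mul_assoc, mul_conjTranspose_self, mul_one]
    have h6 : (P : Matrix (Fin D) (Fin D) ℂ) * ((P : Matrix (Fin D) (Fin D) ℂ)ᴴ * A m
        * (P : Matrix (Fin D) (Fin D) ℂ)) * (Q : Matrix (Fin D) (Fin D) ℂ)ᴴ
        = A m * ((P : Matrix (Fin D) (Fin D) ℂ) * (Q : Matrix (Fin D) (Fin D) ℂ)ᴴ) := by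
      rw [← Matrix.mul_assoc, ← Matrix.mul_assoc, mul_conjTranspose_self, one_mul, Matrix.mul_assoc]
    rw [h5, h6] at h4
    rw [Matrix.UnitaryGroup.mul_val, Matrix.UnitaryGroup.inv_val, Matrix.star_eq_conjTranspose,
      ← h4]
    congr 1
    simp [mul_comm]
  obtain ⟨e1, ω, hω⟩ := hnormal.eq_smul_one_of_twisted_commute hcan
    (Unitary.isUnit_coe (U := P * Q⁻¹)) h3
  have e1' : c g * c k * (c (g * k))⁻¹ = 1 := Circle.coe_eq_one.mp e1
  refine ⟨(mul_inv_eq_one.mp e1').symm, ?_⟩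
  have hωn : ω * conj ω = 1 := by
    have := mul_conjTranspose_self (P * Q⁻¹)
    rw [hω, conjTranspose_smul, smul_mul_smul_comm, conjTranspose_one, mul_one] at this
    simpa using congrFun (congrFun this 0) 0
  refine ⟨⟨ω, ?_⟩, ?_⟩
  · refine mem_sphere_zero_iff_norm.mpr ?_
    rw [Complex.mul_conj, Complex.normSq_eq_norm_sq] at hωn
    have : ‖ω‖ ^ 2 = 1 := by exact_mod_cast hωn
    exact (pow_eq_one_iff_of_nonneg (norm_nonneg _) two_ne_zero).mp this
  · have : ((P * Q⁻¹ * Q : Matrix.unitaryGroup (Fin D) ℂ) : Matrix (Fin D) (Fin D) ℂ)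
        = ω • (Q : Matrix (Fin D) (Fin D) ℂ) := by
      rw [Matrix.UnitaryGroup.mul_val, hω, smul_mul_assoc, one_mul]
    rw [inv_mul_cancel_right] at this
    exact this

theorem ActsVirtually.isProjectiveRep [Group G] [NeZero D] {A : Fin d → Matrix (Fin D) (Fin D) ℂ}
    (hcan : LeftCanonical A) (hnormal : IsNormal A)
    {U : G →* Matrix.unitaryGroup (Fin d) ℂ} {V : G → Matrix.unitaryGroup (Fin D) ℂ}
    {c : G → Circle}
    (h : ActsVirtually A U V c) : IsProjectiveRep V := by
  choose ω hω using fun g k => (h.mul_eq hcan hnormal g k).2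
  exact ⟨ω, hω⟩

/-! ### Schur's lemma and the fusion measurement -/

theorem IsIrreducible.eq_smul_one [NeZero D] {V : G → Matrix.unitaryGroup (Fin D) ℂ}
    (hV : IsIrreducible V) {T : Matrix (Fin D) (Fin D) ℂ}
    (hT : ∀ g, (V g : Matrix (Fin D) (Fin D) ℂ) * T = T * (V g : Matrix (Fin D) (Fin D) ℂ)) :
    T = (T.trace / D) • 1 := by
  obtain ⟨t, ht⟩ := Module.End.exists_eigenvalue (Matrix.toLin' T)
  have htop := (hV (Module.End.eigenspace (Matrix.toLin' T) t) (by
    intro g v hv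
    rw [Module.End.mem_eigenspace_iff, Matrix.toLin'_apply] at hv ⊢
    rw [mulVec_mulVec, ← hT, ← mulVec_mulVec, hv, mulVec_smul])).resolve_left ht
  have h1 : T = t • 1 := by
    apply Matrix.toLin'.injective
    ext1 v
    have : (Pi.single v 1 : Fin D → ℂ) ∈ Module.End.eigenspace (Matrix.toLin' T) t := by
      rw [htop]; trivial
    rw [Module.End.mem_eigenspace_iff] at this
    ext
    simp only [LinearMap.comp_apply, LinearMap.single_apply, this]
    simp
  have hD : (D : ℂ) ≠ 0 := Nat.cast_ne_zero.mpr (NeZero.ne D)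
  have h2 : T.trace / D = t := by rw [h1]; simp [hD]
  rw [h2, ← h1]

/-- Averaging over the conjugation action, in which the phases of the representation cancel. -/
theorem IsProjectiveRep.sum_conj_eq [Group G] [Fintype G] [NeZero D]
    {V : G → Matrix.unitaryGroup (Fin D) ℂ}
    (hP : IsProjectiveRep V) (hV : IsIrreducible V) (M : Matrix (Fin D) (Fin D) ℂ) :
    ∑ g, (V g : Matrix (Fin D) (Fin D) ℂ) * M * (V g : Matrix (Fin D) (Fin D) ℂ)ᴴ
      = ((Fintype.card G : ℂ) * M.trace / D) • 1 := by
  obtain ⟨ω, hω⟩ := hP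
  set T := ∑ g, (V g : Matrix (Fin D) (Fin D) ℂ) * M * (V g : Matrix (Fin D) (Fin D) ℂ)ᴴ with hT
  have hconj : ∀ k, (V k : Matrix (Fin D) (Fin D) ℂ) * T * (V k : Matrix (Fin D) (Fin D) ℂ)ᴴ
      = T := by
    intro k
    conv_rhs => rw [hT, ← Equiv.sum_comp (Equiv.mulLeft k)]
    rw [hT, Finset.mul_sum, Finset.sum_mul]
    refine Finset.sum_congr rfl fun g _ => ?_
    have h1 : (V k : Matrix (Fin D) (Fin D) ℂ) * ((V g : Matrix (Fin D) (Fin D) ℂ) * M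
        * (V g : Matrix (Fin D) (Fin D) ℂ)ᴴ) * (V k : Matrix (Fin D) (Fin D) ℂ)ᴴ
        = ((V k : Matrix (Fin D) (Fin D) ℂ) * (V g : Matrix (Fin D) (Fin D) ℂ)) * M
        * ((V k : Matrix (Fin D) (Fin D) ℂ) * (V g : Matrix (Fin D) (Fin D) ℂ))ᴴ := by
      simp only [conjTranspose_mul, Matrix.mul_assoc]
    have h2 : (ω k g : ℂ) * star (ω k g : ℂ) = 1 := by
      rw [Complex.star_def, Complex.mul_conj, Circle.normSq_coe, Complex.ofReal_one]
    rw [h1, hω, conjTranspose_smul, smul_mul_assoc, smul_mul_smul_comm, h2, one_smul]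
    rfl
  have hcomm : ∀ k, (V k : Matrix (Fin D) (Fin D) ℂ) * T
      = T * (V k : Matrix (Fin D) (Fin D) ℂ) := by
    intro k
    conv_rhs => rw [← hconj k]
    rw [Matrix.mul_assoc, conjTranspose_mul_self, mul_one]
  rw [hV.eq_smul_one hcomm]
  congr 2
  rw [hT, Matrix.trace_sum, Finset.sum_congr rfl fun g _ => by
    rw [Matrix.trace_mul_comm, ← Matrix.mul_assoc, conjTranspose_mul_self, one_mul]]
  simp

/-- The matrix elements of `V_B† V_B` are the Schur orthogonality relations. -/
theorem IsProjectiveRep.isPOVM [Group G] [Fintype G] [NeZero D]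
    {V : G → Matrix.unitaryGroup (Fin D) ℂ}
    (hP : IsProjectiveRep V) (hV : IsIrreducible V) : IsPOVM V := by
  have hD : (D : ℂ) ≠ 0 := Nat.cast_ne_zero.mpr (NeZero.ne D)
  -- entries of the averaged matrix units
  have horth : ∀ i j k l, ∑ g, conj ((V g : Matrix (Fin D) (Fin D) ℂ) i j)
      * (V g : Matrix (Fin D) (Fin D) ℂ) k l
      = if (i, j) = (k, l) then (Fintype.card G : ℂ) / D else 0 := by
    intro i j k l
    have h1 := congrFun (congrFun (hP.sum_conj_eq hV (Matrix.single l j (1 : ℂ))) k) i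
    have h2 : ∀ g, ((V g : Matrix (Fin D) (Fin D) ℂ) * Matrix.single l j (1 : ℂ)
        * (V g : Matrix (Fin D) (Fin D) ℂ)ᴴ) k i = conj ((V g : Matrix (Fin D) (Fin D) ℂ) i j)
      * (V g : Matrix (Fin D) (Fin D) ℂ) k l := by
      intro g
      simp [Matrix.mul_apply, Matrix.single_apply, ite_and, Finset.sum_ite_eq, mul_comm]
    rw [Matrix.sum_apply] at h1
    simp only [h2] at h1
    rw [h1]
    by_cases hlj : l = j
    · subst hlj
      by_cases hik : i = k
      · subst hik; simp
      · simp [hik, Ne.symm hik]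
    · rw [Matrix.trace_single_eq_of_ne _ _ _ hlj]
      simp [Ne.symm hlj]
  rw [IsPOVM]
  ext ⟨i, j⟩ ⟨k, l⟩
  simp only [Matrix.mul_apply, conjTranspose_apply, fusionMap, Matrix.of_apply, star_mul',
    Complex.star_def, Complex.conj_ofReal]
  have hc : ((((D : ℝ) / √(Fintype.card G : ℝ) : ℝ) : ℂ) * ((1 / √(D : ℝ) : ℝ) : ℂ))
      * ((((D : ℝ) / √(Fintype.card G : ℝ) : ℝ) : ℂ) * ((1 / √(D : ℝ) : ℝ) : ℂ))
      = D / Fintype.card G := by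
    have hr : (((D : ℝ) / √(Fintype.card G : ℝ)) * (1 / √(D : ℝ)))
      * (((D : ℝ) / √(Fintype.card G : ℝ)) * (1 / √(D : ℝ))) = D / Fintype.card G := by
      have a1 : √(D : ℝ) * √(D : ℝ) = D := Real.mul_self_sqrt (Nat.cast_nonneg _)
      have a2 : √(Fintype.card G : ℝ) * √(Fintype.card G : ℝ) = Fintype.card G :=
        Real.mul_self_sqrt (Nat.cast_nonneg _)
      have a3 : (D : ℝ) ≠ 0 := Nat.cast_ne_zero.mpr (NeZero.ne D)
      calc _ = (D : ℝ) * D / ((√(Fintype.card G : ℝ) * √(Fintype.card G : ℝ))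
            * (√(D : ℝ) * √(D : ℝ))) := by ring
        _ = _ := by rw [a1, a2, mul_div_mul_right _ _ a3]
    have := congrArg Complex.ofReal hr
    simpa only [Complex.ofReal_mul, Complex.ofReal_div, Complex.ofReal_natCast] using this
  calc _ = ((((D : ℝ) / √(Fintype.card G : ℝ) : ℝ) : ℂ) * ((1 / √(D : ℝ) : ℝ) : ℂ))
      * ((((D : ℝ) / √(Fintype.card G : ℝ) : ℝ) : ℂ) * ((1 / √(D : ℝ) : ℝ) : ℂ))
      * ∑ g, conj ((V g : Matrix (Fin D) (Fin D) ℂ) i j)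
      * (V g : Matrix (Fin D) (Fin D) ℂ) k l := by
        rw [Finset.mul_sum]
        exact Finset.sum_congr rfl fun g _ => by ring
    _ = _ := by
        rw [hc, horth, Matrix.one_apply, mul_ite, mul_zero]
        congr 1
        field_simp

/-! ### Pushing defects through a site -/

/-- A virtual unitary `W` that a unitary on the physical index moves from the right to the left
virtual leg of the tensor. -/
def Pushable (A : Fin d → Matrix (Fin D) (Fin D) ℂ) (W : Matrix.unitaryGroup (Fin D) ℂ) : Prop :=
  ∃ O : Matrix.unitaryGroup (Fin d) ℂ, ∀ m,
    act (O : Matrix (Fin d) (Fin d) ℂ) A m * (W : Matrix (Fin D) (Fin D) ℂ)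
      = (W : Matrix (Fin D) (Fin D) ℂ) * A m

theorem pushable_one (A : Fin d → Matrix (Fin D) (Fin D) ℂ) : Pushable A 1 :=
  ⟨1, fun m => by simp⟩

theorem Pushable.mul {A : Fin d → Matrix (Fin D) (Fin D) ℂ} {W W' : Matrix.unitaryGroup (Fin D) ℂ}
    (h : Pushable A W) (h' : Pushable A W') : Pushable A (W * W') := by
  obtain ⟨O, hO⟩ := h
  obtain ⟨O', hO'⟩ := h'
  refine ⟨O' * O, fun m => ?_⟩
  have h1 : act (O : Matrix (Fin d) (Fin d) ℂ) A = fun m => (1 : ℂ) •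
      ((W : Matrix (Fin D) (Fin D) ℂ) * A m * (W : Matrix (Fin D) (Fin D) ℂ)ᴴ) := by
    funext m
    rw [one_smul, ← hO, Matrix.mul_assoc, mul_conjTranspose_self, mul_one]
  rw [Matrix.UnitaryGroup.mul_val O' O, ← act_act, h1, act_smul_mul_mul, one_smul,
    Matrix.UnitaryGroup.mul_val, ← Matrix.mul_assoc,
    Matrix.mul_assoc _ _ (W : Matrix (Fin D) (Fin D) ℂ), conjTranspose_mul_self, mul_one,
    Matrix.mul_assoc, hO', Matrix.mul_assoc]

theorem exists_unitary_smul (t : Circle) (O : Matrix.unitaryGroup (Fin d) ℂ) :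
    ∃ O' : Matrix.unitaryGroup (Fin d) ℂ,
      (O' : Matrix (Fin d) (Fin d) ℂ) = (t : ℂ) • (O : Matrix (Fin d) (Fin d) ℂ) := by
  refine ⟨⟨(t : ℂ) • (O : Matrix (Fin d) (Fin d) ℂ), Matrix.mem_unitaryGroup_iff'.mpr ?_⟩, rfl⟩
  have h2 : star (t : ℂ) * (t : ℂ) = 1 := by
    rw [Complex.star_def, mul_comm, Complex.mul_conj, Circle.normSq_coe, Complex.ofReal_one]
  rw [star_smul, smul_mul_smul_comm, h2, one_smul]
  exact Matrix.UnitaryGroup.star_mul_self O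

theorem smul_act (t : ℂ) (O : Matrix (Fin d) (Fin d) ℂ) (A : Fin d → Matrix (Fin D) (Fin D) ℂ)
    (m : Fin d) : act (t • O) A m = t • act O A m := by
  simp [act, Finset.smul_sum, smul_smul]

theorem ActsVirtually.pushable [Group G] {A : Fin d → Matrix (Fin D) (Fin D) ℂ}
    {U : G →* Matrix.unitaryGroup (Fin d) ℂ} {V : G → Matrix.unitaryGroup (Fin D) ℂ}
    {c : G → Circle}
    (h : ActsVirtually A U V c) (g : G) : Pushable A (V g) := by
  obtain ⟨O, hO⟩ := exists_unitary_smul (c g) (U g)⁻¹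
  refine ⟨O, fun m => ?_⟩
  have h1 : act (U g : Matrix (Fin d) (Fin d) ℂ) A = fun m => (c g : ℂ) •
      ((V g : Matrix (Fin D) (Fin D) ℂ)ᴴ * A m * (V g : Matrix (Fin D) (Fin D) ℂ)) :=
    funext (h.act_eq g)
  have h2 : act ((U g)⁻¹ : Matrix.unitaryGroup (Fin d) ℂ)
      (act (U g : Matrix (Fin d) (Fin d) ℂ) A) m = A m := by
    rw [act_act, ← Matrix.UnitaryGroup.mul_val, inv_mul_cancel]
    simp
  rw [h1, act_smul_mul_mul] at h2
  rw [hO, smul_act, ← h2, mul_smul_comm, smul_mul_assoc, ← Matrix.mul_assoc, ← Matrix.mul_assoc,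
    mul_conjTranspose_self, one_mul]

theorem ActsVirtually.defectsCorrectable [Group G] [NeZero D]
    {A : Fin d → Matrix (Fin D) (Fin D) ℂ} (hcan : LeftCanonical A) (hnormal : IsNormal A)
    {U : G →* Matrix.unitaryGroup (Fin d) ℂ} {V : G → Matrix.unitaryGroup (Fin D) ℂ}
    {c : G → Circle}
    (h : ActsVirtually A U V c) : DefectsCorrectable A V := by
  intro g
  -- `V_{g⁻¹}` is the adjoint of `V_g` up to a phase
  obtain ⟨-, ω, hω⟩ := h.mul_eq hcan hnormal g⁻¹ g
  obtain ⟨-, ω', hω'⟩ := h.mul_eq hcan hnormal (1 : G) 1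
  rw [inv_mul_cancel] at hω
  rw [mul_one] at hω'
  have hone : (V 1 : Matrix (Fin D) (Fin D) ℂ) = (ω' : ℂ) • 1 := by
    have := congrArg (· * (V 1 : Matrix (Fin D) (Fin D) ℂ)ᴴ) hω'
    simpa [Matrix.mul_assoc, mul_conjTranspose_self] using this
  have hinv : (V g⁻¹ : Matrix (Fin D) (Fin D) ℂ)
      = ((ω * ω' : Circle) : ℂ) • (V g : Matrix (Fin D) (Fin D) ℂ)ᴴ := by
    have := congrArg (· * (V g : Matrix (Fin D) (Fin D) ℂ)ᴴ) hω
    simpa [Matrix.mul_assoc, mul_conjTranspose_self, hone, smul_smul] using this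
  obtain ⟨O, hO⟩ := exists_unitary_smul (ω * ω' * (c g)⁻¹) (U g)
  have hact : ∀ m, act (O : Matrix (Fin d) (Fin d) ℂ) A m
      = (V g⁻¹ : Matrix (Fin D) (Fin D) ℂ) * A m * (V g : Matrix (Fin D) (Fin D) ℂ) := by
    intro m
    rw [hO, smul_act, h.act_eq, smul_smul, hinv, smul_mul_assoc, smul_mul_assoc, ← Circle.coe_mul,
      inv_mul_cancel_right]
  set K := (V g⁻¹ : Matrix (Fin D) (Fin D) ℂ)ᵀ ⊗ₖ (V g : Matrix (Fin D) (Fin D) ℂ) with hK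
  set Ab := virtualToPhysical A
  have hOA : (O : Matrix (Fin d) (Fin d) ℂ) * Ab = Ab * K := by
    ext m ⟨i, j⟩
    have := congrFun (congrFun (hact m) i) j
    simp only [act, Matrix.sum_apply, Matrix.smul_apply, smul_eq_mul, Matrix.mul_apply] at this
    simp only [Matrix.mul_apply, Ab, virtualToPhysical, Matrix.of_apply, this, hK,
      Matrix.kroneckerMap_apply, Matrix.transpose_apply, Fintype.sum_prod_type, Finset.sum_mul]
    rw [Finset.sum_comm]
    exact Finset.sum_congr rfl fun k _ => Finset.sum_congr rfl fun l _ => by ring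
  refine ⟨g⁻¹, ⟨O, hOA⟩, ?_⟩
  have hKK : K * Kᴴ = 1 := by
    have ht : (V g⁻¹ : Matrix (Fin D) (Fin D) ℂ)ᵀ * (V g⁻¹ : Matrix (Fin D) (Fin D) ℂ)ᵀᴴ = 1 := by
      change (V g⁻¹ : Matrix (Fin D) (Fin D) ℂ)ᵀ * (V g⁻¹ : Matrix (Fin D) (Fin D) ℂ)ᴴᵀ = 1
      rw [← Matrix.transpose_mul, conjTranspose_mul_self,
        Matrix.transpose_one]
    rw [hK, Matrix.conjTranspose_kronecker, ← Matrix.mul_kronecker_mul, ht, mul_conjTranspose_self,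
      Matrix.one_kronecker_one]
  have hgram : Kᴴ * (Abᴴ * Ab) * K = Abᴴ * Ab := by
    calc _ = (Ab * K)ᴴ * (Ab * K) := by simp only [conjTranspose_mul, Matrix.mul_assoc]
      _ = Abᴴ * ((O : Matrix (Fin d) (Fin d) ℂ)ᴴ * (O : Matrix (Fin d) (Fin d) ℂ)) * Ab := by
        rw [← hOA]; simp only [conjTranspose_mul, Matrix.mul_assoc]
      _ = _ := by rw [conjTranspose_mul_self, Matrix.mul_one]
  show K * (Abᴴ * Ab) = Abᴴ * Ab * K
  conv_lhs => rw [← hgram]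
  rw [← Matrix.mul_assoc, ← Matrix.mul_assoc, hKK, one_mul]

/-! ### Relaxation of the transfer map -/

/-- The square of the Frobenius norm. -/
def frobeniusSq (Y : Matrix (Fin D) (Fin D) ℂ) : ℝ := ∑ i, ∑ j, ‖Y i j‖ ^ 2

theorem frobeniusSq_nonneg (Y : Matrix (Fin D) (Fin D) ℂ) : 0 ≤ frobeniusSq Y :=
  Finset.sum_nonneg fun _ _ => Finset.sum_nonneg fun _ _ => sq_nonneg _

theorem frobeniusSq_eq_zero {Y : Matrix (Fin D) (Fin D) ℂ} (h : frobeniusSq Y = 0) : Y = 0 := by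
  ext i j
  have h1 := (Finset.sum_eq_zero_iff_of_nonneg
    fun i _ => Finset.sum_nonneg fun j _ => sq_nonneg ‖Y i j‖).mp h i (Finset.mem_univ _)
  have h2 := (Finset.sum_eq_zero_iff_of_nonneg
    fun j _ => sq_nonneg ‖Y i j‖).mp h1 j (Finset.mem_univ _)
  simpa using h2

theorem frobeniusSq_eq_trace (Y : Matrix (Fin D) (Fin D) ℂ) :
    (frobeniusSq Y : ℂ) = (Yᴴ * Y).trace := by
  rw [Matrix.trace, frobeniusSq, Finset.sum_comm]
  push_cast
  refine Finset.sum_congr rfl fun i _ => ?_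
  rw [Matrix.diag_apply, Matrix.mul_apply]
  refine Finset.sum_congr rfl fun j _ => ?_
  rw [conjTranspose_apply, Complex.star_def, mul_comm, Complex.mul_conj, Complex.normSq_eq_norm_sq]
  push_cast; rfl

theorem norm_sq_apply_le_frobeniusSq (Y : Matrix (Fin D) (Fin D) ℂ) (i j : Fin D) :
    ‖Y i j‖ ^ 2 ≤ frobeniusSq Y :=
  calc ‖Y i j‖ ^ 2 ≤ ∑ j, ‖Y i j‖ ^ 2 :=
        Finset.single_le_sum (f := fun j => ‖Y i j‖ ^ 2) (fun _ _ => sq_nonneg _)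
          (Finset.mem_univ j)
    _ ≤ frobeniusSq Y :=
        Finset.single_le_sum (f := fun i => ∑ j, ‖Y i j‖ ^ 2)
          (fun _ _ => Finset.sum_nonneg fun _ _ => sq_nonneg _) (Finset.mem_univ i)

theorem continuous_frobeniusSq : Continuous (frobeniusSq (D := D)) := by
  unfold frobeniusSq
  fun_prop

/-- For a doubly stochastic family of Kraus operators the loss of Frobenius norm under the dual
channel is a sum of squares of twisted commutators. -/
theorem frobeniusSq_sub_frobeniusSq_sum {ι : Type*} [Fintype ι] (K : ι → Matrix (Fin D) (Fin D) ℂ)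
    (h1 : ∑ w, (K w)ᴴ * K w = 1) (h2 : ∑ w, K w * (K w)ᴴ = 1) (Y : Matrix (Fin D) (Fin D) ℂ) :
    frobeniusSq Y - frobeniusSq (∑ w, (K w)ᴴ * Y * K w)
      = ∑ w, frobeniusSq (K w * (∑ w', (K w')ᴴ * Y * K w') - Y * K w) := by
  generalize hΦ : ∑ w, (K w)ᴴ * Y * K w = Φ
  have hΦ' : ∑ w, (K w)ᴴ * Yᴴ * K w = Φᴴ := by
    rw [← hΦ, conjTranspose_sum]
    simp only [conjTranspose_mul, conjTranspose_conjTranspose, Matrix.mul_assoc]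
  apply Complex.ofReal_injective
  push_cast
  simp only [frobeniusSq_eq_trace, conjTranspose_sub, conjTranspose_mul, sub_mul, mul_sub,
    Matrix.trace_sub, Finset.sum_sub_distrib]
  have e1 : ∑ w, (Φᴴ * (K w)ᴴ * (K w * Φ)).trace = (Φᴴ * Φ).trace := by
    calc _ = (Φᴴ * (∑ w, (K w)ᴴ * K w) * Φ).trace := by
          rw [Finset.mul_sum, Finset.sum_mul, Matrix.trace_sum]
          simp only [Matrix.mul_assoc]
      _ = _ := by rw [h1, mul_one]
  have e2 : ∑ w, (Φᴴ * (K w)ᴴ * (Y * K w)).trace = (Φᴴ * Φ).trace := by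
    calc _ = (Φᴴ * (∑ w, (K w)ᴴ * Y * K w)).trace := by
          rw [Finset.mul_sum, Matrix.trace_sum]
          simp only [Matrix.mul_assoc]
      _ = _ := by rw [hΦ]
  have e3 : ∑ w, ((K w)ᴴ * Yᴴ * (K w * Φ)).trace = (Φᴴ * Φ).trace := by
    calc _ = ((∑ w, (K w)ᴴ * Yᴴ * K w) * Φ).trace := by
          rw [Finset.sum_mul, Matrix.trace_sum]
          simp only [Matrix.mul_assoc]
      _ = _ := by rw [hΦ']
  have e4 : ∑ w, ((K w)ᴴ * Yᴴ * (Y * K w)).trace = (Yᴴ * Y).trace := by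
    calc _ = ∑ w, (Yᴴ * Y * (K w * (K w)ᴴ)).trace := by
          refine Finset.sum_congr rfl fun w _ => ?_
          rw [Matrix.mul_assoc, Matrix.trace_mul_comm]
          simp only [Matrix.mul_assoc]
      _ = (Yᴴ * Y * (∑ w, K w * (K w)ᴴ)).trace := by rw [Finset.mul_sum, Matrix.trace_sum]
      _ = _ := by rw [h2, mul_one]
  rw [e1, e2, e3, e4]
  ring

theorem transfer_pow_apply (A : Fin d → Matrix (Fin D) (Fin D) ℂ) (N : ℕ)
    (Y : Matrix (Fin D) (Fin D) ℂ) :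
    (transfer A ^ N) Y = ∑ m : Fin N → Fin d, (word A m)ᴴ * Y * word A m := by
  induction N generalizing Y with
  | zero => simp [word]
  | succ N ih =>
    rw [pow_succ, Module.End.mul_apply, ih, transfer_apply,
      ← (Fin.consEquiv fun _ => Fin d).sum_comp, Fintype.sum_prod_type, Finset.sum_comm]
    refine Finset.sum_congr rfl fun n _ => ?_
    rw [Finset.mul_sum, Finset.sum_mul]
    refine Finset.sum_congr rfl fun a _ => ?_
    simp [word_succ, Fin.consEquiv, Matrix.mul_assoc]

/-- Right-canonical form. -/
def RightCanonical (A : Fin d → Matrix (Fin D) (Fin D) ℂ) : Prop :=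
  ∑ m, A m * (A m)ᴴ = 1

theorem RightCanonical.sum_word {A : Fin d → Matrix (Fin D) (Fin D) ℂ} (h : RightCanonical A)
    (N : ℕ) : ∑ m : Fin N → Fin d, word A m * (word A m)ᴴ = 1 := by
  induction N with
  | zero => simp [word]
  | succ N ih =>
    rw [← (Fin.consEquiv fun _ => Fin d).sum_comp, Fintype.sum_prod_type, ← h]
    refine Finset.sum_congr rfl fun a _ => ?_
    calc _ = A a * (∑ m : Fin N → Fin d, word A m * (word A m)ᴴ) * (A a)ᴴ := by
          rw [Finset.mul_sum, Finset.sum_mul]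
          refine Finset.sum_congr rfl fun n _ => ?_
          simp [word_succ, Fin.consEquiv, Matrix.mul_assoc]
      _ = _ := by rw [ih, mul_one]

theorem LeftCanonical.transfer_pow_one {A : Fin d → Matrix (Fin D) (Fin D) ℂ}
    (h : LeftCanonical A) (N : ℕ) : (transfer A ^ N) 1 = 1 := by
  induction N with
  | zero => simp
  | succ N ih => rw [pow_succ, Module.End.mul_apply, h.transfer_one, ih]

theorem LeftCanonical.sum_word {A : Fin d → Matrix (Fin D) (Fin D) ℂ} (h : LeftCanonical A)
    (N : ℕ) : ∑ m : Fin N → Fin d, (word A m)ᴴ * word A m = 1 := by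
  have h1 := h.transfer_pow_one N
  rw [transfer_pow_apply] at h1
  simpa using h1

theorem frobeniusSq_transfer_pow_le {A : Fin d → Matrix (Fin D) (Fin D) ℂ} (hl : LeftCanonical A)
    (hr : RightCanonical A) (N : ℕ) (Y : Matrix (Fin D) (Fin D) ℂ) :
    frobeniusSq ((transfer A ^ N) Y) ≤ frobeniusSq Y := by
  have := frobeniusSq_sub_frobeniusSq_sum (fun m : Fin N → Fin d => word A m) (hl.sum_word N)
    (hr.sum_word N) Y
  rw [transfer_pow_apply]
  refine sub_nonneg.mp ?_
  rw [this]
  exact Finset.sum_nonneg fun _ _ => frobeniusSq_nonneg _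

theorem RightCanonical.trace_transfer {A : Fin d → Matrix (Fin D) (Fin D) ℂ}
    (hr : RightCanonical A) (Y : Matrix (Fin D) (Fin D) ℂ) :
    (transfer A Y).trace = Y.trace := by
  rw [transfer_apply, Matrix.trace_sum]
  calc _ = ∑ m, (Y * (A m * (A m)ᴴ)).trace := by
        refine Finset.sum_congr rfl fun m _ => ?_
        rw [Matrix.mul_assoc, Matrix.trace_mul_comm, Matrix.mul_assoc]
    _ = _ := by rw [← Matrix.trace_sum, ← Finset.mul_sum, hr, mul_one]

theorem RightCanonical.trace_transfer_pow {A : Fin d → Matrix (Fin D) (Fin D) ℂ}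
    (hr : RightCanonical A) (N : ℕ) (Y : Matrix (Fin D) (Fin D) ℂ) :
    ((transfer A ^ N) Y).trace = Y.trace := by
  induction N generalizing Y with
  | zero => simp
  | succ N ih => rw [pow_succ, Module.End.mul_apply, ih, hr.trace_transfer]

/-- After as many steps as it takes for the words to span all matrices, the dual transfer map
strictly decreases the norm of every nonzero traceless matrix. -/
theorem eq_zero_of_frobeniusSq_transfer_pow_eq [NeZero D] {A : Fin d → Matrix (Fin D) (Fin D) ℂ}
    (hl : LeftCanonical A) (hr : RightCanonical A) {L : ℕ}
    (hL : Submodule.span ℂ (Set.range fun m : Fin L → Fin d => word A m) = ⊤)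
    {Y : Matrix (Fin D) (Fin D) ℂ} (htr : Y.trace = 0)
    (hY : frobeniusSq ((transfer A ^ L) Y) = frobeniusSq Y) : Y = 0 := by
  have h1 := frobeniusSq_sub_frobeniusSq_sum (fun m : Fin L → Fin d => word A m) (hl.sum_word L)
    (hr.sum_word L) Y
  rw [← transfer_pow_apply, hY, sub_self] at h1
  set Φ := (transfer A ^ L) Y
  have h2 : ∀ w : Fin L → Fin d, word A w * Φ = Y * word A w := fun w =>
    sub_eq_zero.mp (frobeniusSq_eq_zero ((Finset.sum_eq_zero_iff_of_nonneg
      fun _ _ => frobeniusSq_nonneg _).mp h1.symm w (Finset.mem_univ _)))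
  have h3 : ∀ M, M * Φ = Y * M := by
    intro M
    have hM : M ∈ Submodule.span ℂ (Set.range fun m : Fin L → Fin d => word A m) := by
      rw [hL]; trivial
    induction hM using Submodule.span_induction with
    | mem M hM => obtain ⟨m, rfl⟩ := hM; exact h2 m
    | zero => simp
    | add x y _ _ hx hy => rw [add_mul, hx, hy, mul_add]
    | smul c x _ hx => rw [smul_mul_assoc, hx, mul_smul_comm]
  have h4 : Φ = Y := by simpa using h3 1
  obtain ⟨y, rfl⟩ := eq_smul_one_of_commute (W := Y) fun M => by rw [← h3 M, h4]
  have hD : (D : ℂ) ≠ 0 := Nat.cast_ne_zero.mpr (NeZero.ne D)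
  have : y = 0 := by simpa [hD] using htr
  rw [this, zero_smul]

/-- The transfer map of a normal tensor in left- and right-canonical form relaxes to the
completely depolarising channel. The norms of the iterates of a traceless matrix decrease to a
limit, which is also the norm of a cluster point `Z`; as the transfer map cannot decrease the norm
of `Z` any further, `Z = 0`. -/
theorem tendsto_transfer_pow [NeZero D] {A : Fin d → Matrix (Fin D) (Fin D) ℂ}
    (hl : LeftCanonical A) (hr : RightCanonical A) (hnormal : IsNormal A)
    (Y : Matrix (Fin D) (Fin D) ℂ) :
    Tendsto (fun N => (transfer A ^ N) Y) atTop (𝓝 ((Y.trace / D) • 1)) := by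
  have hD : (D : ℂ) ≠ 0 := Nat.cast_ne_zero.mpr (NeZero.ne D)
  suffices h : ∀ Y : Matrix (Fin D) (Fin D) ℂ, Y.trace = 0 →
      Tendsto (fun N => (transfer A ^ N) Y) atTop (𝓝 0) by
    have := (h (Y - (Y.trace / D) • 1) (by simp [hD])).add_const ((Y.trace / D) • 1)
    simpa [hl.transfer_pow_one] using this
  intro Y hY
  obtain ⟨L, -, hL⟩ := hnormal
  set u : ℕ → Matrix (Fin D) (Fin D) ℂ := fun N => (transfer A ^ N) Y with hu
  have hadd : ∀ k N, (transfer A ^ k) (u N) = u (k + N) := fun k N => by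
    simp only [hu, pow_add, Module.End.mul_apply]
  have hanti : Antitone fun N => frobeniusSq (u N) := antitone_nat_of_succ_le fun N => by
    rw [add_comm, ← hadd]; exact frobeniusSq_transfer_pow_le hl hr 1 _
  obtain ⟨a, ha⟩ : ∃ a, Tendsto (fun N => frobeniusSq (u N)) atTop (𝓝 a) :=
    ⟨_, tendsto_atTop_ciInf hanti ⟨0, by rintro _ ⟨N, rfl⟩; exact frobeniusSq_nonneg _⟩⟩
  have hbound : ∀ N i j, ‖u N i j‖ ≤ √(frobeniusSq Y) := fun N i j =>
    Real.le_sqrt_of_sq_le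
      ((norm_sq_apply_le_frobeniusSq _ i j).trans (frobeniusSq_transfer_pow_le hl hr N Y))
  have hcpt : IsCompact (Set.univ.pi fun _ : Fin D => Set.univ.pi fun _ : Fin D =>
      Metric.closedBall (0 : ℂ) √(frobeniusSq Y)) :=
    isCompact_univ_pi fun _ => isCompact_univ_pi fun _ => isCompact_closedBall _ _
  obtain ⟨Z, φ, hφ, hZ⟩ : ∃ (Z : Matrix (Fin D) (Fin D) ℂ) (φ : ℕ → ℕ), StrictMono φ ∧
      Tendsto (u ∘ φ) atTop (𝓝 Z) := by
    obtain ⟨Z, -, φ, hφ, hZ⟩ := IsCompact.tendsto_subseq (X := Fin D → Fin D → ℂ) hcpt (x := u)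
      fun N i _ j _ => by simpa using hbound N i j
    exact ⟨Z, φ, hφ, hZ⟩
  have hZa : frobeniusSq Z = a :=
    tendsto_nhds_unique ((continuous_frobeniusSq.tendsto Z).comp hZ) (ha.comp hφ.tendsto_atTop)
  have hcont : Continuous (transfer A ^ L) := LinearMap.continuous_of_finiteDimensional _
  have hZL : frobeniusSq ((transfer A ^ L) Z) = a := by
    refine tendsto_nhds_unique ((continuous_frobeniusSq.comp hcont).tendsto Z |>.comp hZ) ?_
    have : Tendsto (fun N => L + φ N) atTop atTop :=
      tendsto_atTop_mono (fun N => Nat.le_add_left _ _) hφ.tendsto_atTop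
    refine (ha.comp this).congr fun N => ?_
    simp [hadd]
  have hZtr : Z.trace = 0 := by
    have hc : Continuous (Matrix.trace : Matrix (Fin D) (Fin D) ℂ → ℂ) := by fun_prop
    refine tendsto_nhds_unique ((hc.tendsto Z).comp hZ) ?_
    refine tendsto_const_nhds.congr fun N => ?_
    simp [hu, hr.trace_transfer_pow, hY]
  have hZ0 := eq_zero_of_frobeniusSq_transfer_pow_eq hl hr hL hZtr (hZL.trans hZa.symm)
  have ha0 : a = 0 := by rw [← hZa, hZ0]; simp [frobeniusSq]
  rw [ha0] at ha
  have hent : ∀ i j, Tendsto (fun N => u N i j) atTop (𝓝 0) := by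
    intro i j
    refine squeeze_zero_norm (a := fun N => √(frobeniusSq (u N)))
      (fun N => Real.le_sqrt_of_sq_le (norm_sq_apply_le_frobeniusSq _ i j)) ?_
    have := (Real.continuous_sqrt.tendsto 0).comp ha
    rw [Real.sqrt_zero] at this
    exact this
  exact tendsto_pi_nhds.mpr fun i => tendsto_pi_nhds.mpr fun j => hent i j

/-! ### Measuring the edges -/

/-- Irreducibility of the virtual representation makes the fixed point of the transfer map
maximally mixed. -/
theorem ActsVirtually.rightCanonical [Group G] [NeZero D]
    {A : Fin d → Matrix (Fin D) (Fin D) ℂ} (hcan : LeftCanonical A)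
    {U : G →* Matrix.unitaryGroup (Fin d) ℂ} {V : G → Matrix.unitaryGroup (Fin D) ℂ}
    {c : G → Circle}
    (h : ActsVirtually A U V c) (hV : IsIrreducible V) : RightCanonical A := by
  have hD : (D : ℂ) ≠ 0 := Nat.cast_ne_zero.mpr (NeZero.ne D)
  set M := ∑ m, A m * (A m)ᴴ with hM
  have hconj : ∀ g, (V g : Matrix (Fin D) (Fin D) ℂ)ᴴ * M * (V g : Matrix (Fin D) (Fin D) ℂ)
      = M := by
    intro g
    have h1 := sum_act (U g) A (LinearMap.mk₂'ₛₗ (starRingEnd ℂ) (RingHom.id ℂ)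
      (fun X Y => Y * Xᴴ) (by intros; simp [mul_add]) (by intros; simp)
      (by intros; simp [add_mul]) (by intros; simp))
    simp only [LinearMap.mk₂'ₛₗ_apply] at h1
    rw [← hM] at h1
    conv_rhs => rw [← h1]
    rw [hM, Finset.mul_sum, Finset.sum_mul]
    refine Finset.sum_congr rfl fun m _ => ?_
    have h2 : (c g : ℂ) * star (c g : ℂ) = 1 := by
      rw [Complex.star_def, Complex.mul_conj, Circle.normSq_coe, Complex.ofReal_one]
    rw [h.act_eq, conjTranspose_smul, smul_mul_smul_comm, h2, one_smul]
    simp only [conjTranspose_mul, conjTranspose_conjTranspose, Matrix.mul_assoc]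
    rw [← Matrix.mul_assoc (V g : Matrix (Fin D) (Fin D) ℂ) (V g : Matrix (Fin D) (Fin D) ℂ)ᴴ,
      mul_conjTranspose_self, one_mul]
  have hcomm : ∀ g, (V g : Matrix (Fin D) (Fin D) ℂ) * M
      = M * (V g : Matrix (Fin D) (Fin D) ℂ) := by
    intro g
    conv_lhs => rw [← hconj g]
    rw [← Matrix.mul_assoc, ← Matrix.mul_assoc, mul_conjTranspose_self, one_mul]
  have htr : M.trace = D := by
    rw [hM, Matrix.trace_sum]
    calc _ = (∑ m, (A m)ᴴ * A m).trace := by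
          rw [Matrix.trace_sum]
          exact Finset.sum_congr rfl fun m _ => Matrix.trace_mul_comm _ _
      _ = _ := by rw [hcan]; simp
  rw [RightCanonical, ← hM, hV.eq_smul_one hcomm, htr, div_self hD, one_smul]

theorem edgeProjected_eq (A : Fin d → Matrix (Fin D) (Fin D) ℂ) (b : Matrix (Fin D) (Fin D) ℂ)
    {N : ℕ} (m : Fin N → Fin d) :
    edgeProjected A b m = ((1 / √(D : ℝ) : ℝ) : ℂ) * state A bᴴ m := by
  simp only [edgeProjected, entangledState, state, Matrix.trace, Matrix.diag_apply,
    Matrix.mul_apply, conjTranspose_apply, Finset.mul_sum]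
  refine Finset.sum_congr rfl fun l _ => Finset.sum_congr rfl fun r _ => ?_
  rw [Complex.star_def]; ring

theorem sum_norm_sq_state_eq (A : Fin d → Matrix (Fin D) (Fin D) ℂ)
    (b : Matrix (Fin D) (Fin D) ℂ) (N : ℕ) :
    ((∑ m : Fin N → Fin d, ‖state A bᴴ m‖ ^ 2 : ℝ) : ℂ)
      = ∑ l, ∑ r, ∑ l', ∑ r', conj (b l r) * b l' r'
        * (transfer A ^ N) (Matrix.single l' l 1) r' r := by
  have hent : ∀ l r l' r', (transfer A ^ N) (Matrix.single l' l 1) r' r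
      = ∑ m : Fin N → Fin d, conj (word A m l' r') * word A m l r := by
    intro l r l' r'
    rw [transfer_pow_apply, Matrix.sum_apply]
    refine Finset.sum_congr rfl fun m _ => ?_
    simp [Matrix.mul_apply, Matrix.single_apply, ite_and, Finset.sum_ite_eq]
  have hst : ∀ m : Fin N → Fin d, state A bᴴ m = ∑ l, ∑ r, conj (b l r) * word A m l r := by
    intro m
    simp [state, Matrix.trace, Matrix.mul_apply, mul_comm]
  have hsq : ∀ m : Fin N → Fin d, ((‖state A bᴴ m‖ ^ 2 : ℝ) : ℂ)
      = ∑ l, ∑ r, ∑ l', ∑ r', conj (b l r) * b l' r'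
        * (conj (word A m l' r') * word A m l r) := by
    intro m
    rw [← Complex.normSq_eq_norm_sq, ← Complex.mul_conj, hst, map_sum, Finset.sum_mul]
    refine Finset.sum_congr rfl fun l _ => ?_
    rw [Finset.sum_mul]
    refine Finset.sum_congr rfl fun r _ => ?_
    rw [Finset.mul_sum]
    refine Finset.sum_congr rfl fun l' _ => ?_
    rw [map_sum, Finset.mul_sum]
    refine Finset.sum_congr rfl fun r' _ => ?_
    rw [map_mul, Complex.conj_conj]
    ring
  rw [Complex.ofReal_sum, Finset.sum_congr rfl fun m _ => hsq m]
  simp only [hent, Finset.mul_sum]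
  rw [Finset.sum_comm]
  refine Finset.sum_congr rfl fun l _ => ?_
  rw [Finset.sum_comm]
  refine Finset.sum_congr rfl fun r _ => ?_
  rw [Finset.sum_comm]
  refine Finset.sum_congr rfl fun l' _ => ?_
  rw [Finset.sum_comm]

theorem edgeMeasurement_of_canonical [NeZero D] {A : Fin d → Matrix (Fin D) (Fin D) ℂ}
    (hl : LeftCanonical A) (hr : RightCanonical A) (hnormal : IsNormal A) :
    EdgeMeasurement A := by
  intro b hb
  refine ⟨fun N m => edgeProjected_eq A b m, ?_⟩
  have hD : (D : ℂ) ≠ 0 := Nat.cast_ne_zero.mpr (NeZero.ne D)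
  have h1 : ∀ N : ℕ, ∑ m : Fin N → Fin d, ‖edgeProjected A b m‖ ^ 2
      = 1 / D * ∑ m : Fin N → Fin d, ‖state A bᴴ m‖ ^ 2 := by
    intro N
    rw [Finset.mul_sum]
    refine Finset.sum_congr rfl fun m _ => ?_
    rw [edgeProjected_eq, norm_mul, mul_pow, Complex.norm_real, Real.norm_eq_abs, sq_abs, div_pow,
      Real.sq_sqrt (Nat.cast_nonneg _), one_pow]
  simp only [h1]
  have h2 : Tendsto (fun N : ℕ => ((∑ m : Fin N → Fin d, ‖state A bᴴ m‖ ^ 2 : ℝ) : ℂ)) atTop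
      (𝓝 (∑ l, ∑ r, ∑ l', ∑ r', conj (b l r) * b l' r'
        * (((Matrix.single l' l (1 : ℂ)).trace / D) • (1 : Matrix (Fin D) (Fin D) ℂ)) r' r)) := by
    simp only [sum_norm_sq_state_eq]
    refine tendsto_finsetSum _ fun l _ => tendsto_finsetSum _ fun r _ =>
      tendsto_finsetSum _ fun l' _ => tendsto_finsetSum _ fun r' _ => Tendsto.const_mul _ ?_
    exact tendsto_pi_nhds.mp (tendsto_pi_nhds.mp
      (tendsto_transfer_pow hl hr hnormal (Matrix.single l' l 1)) r') r
  have h3 : ∑ l, ∑ r, ∑ l', ∑ r', conj (b l r) * b l' r'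
        * (((Matrix.single l' l (1 : ℂ)).trace / D) • (1 : Matrix (Fin D) (Fin D) ℂ)) r' r
      = ((1 / D : ℝ) : ℂ) := by
    have : ∀ l r : Fin D, ∑ l', ∑ r', conj (b l r) * b l' r'
        * (((Matrix.single l' l (1 : ℂ)).trace / D) • (1 : Matrix (Fin D) (Fin D) ℂ)) r' r
        = ((‖b l r‖ ^ 2 : ℝ) : ℂ) * (1 / D) := by
      intro l r
      rw [Finset.sum_eq_single l, Finset.sum_eq_single r]
      · rw [← Complex.normSq_eq_norm_sq, ← Complex.mul_conj]
        simp [div_eq_mul_inv, mul_comm]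
      · intro r' _ hr'; simp [hr']
      · simp
      · intro l' _ hl'
        simp [Matrix.trace_single_eq_of_ne _ _ _ hl']
      · simp
    simp only [this, ← Finset.sum_mul, ← Complex.ofReal_sum, hb]
    simp
  rw [h3] at h2
  have h4 := (Complex.continuous_re.tendsto _).comp h2
  simp only [Function.comp_def, Complex.ofReal_re] at h4
  have h5 := h4.const_mul (1 / (D : ℝ))
  rwa [show (1 / (D : ℝ)) * (1 / D) = 1 / (D : ℝ) ^ 2 by ring] at h5

end MPS

/-! ### Local layers -/

namespace AdaptiveCircuits

variable {W : Type} [Fintype W] [DecidableEq W]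

/-- The function `F` of two configurations is the matrix element of a unitary on the qudits of the
cell labelled `c`. -/
def IsCellGate (dim : W → ℕ) (cell : W → W) (c : W) (F : Config dim → Config dim → ℂ) : Prop :=
  ∃ M : Matrix.unitaryGroup (∀ w : {w : W // cell w = c}, Fin (dim w)) ℂ, ∀ x y : Config dim,
    F x y = (M : Matrix (∀ w : {w : W // cell w = c}, Fin (dim w))
      (∀ w : {w : W // cell w = c}, Fin (dim w)) ℂ) (fun w => x w) (fun w => y w)

theorem isLocalLayer_of_isCellGate {dim site : W → ℕ} {r : ℕ}
    {O : Matrix (Config dim) (Config dim) ℂ} (cell : W → W)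
    (hcell : ∀ w w' : W, cell w = cell w' → Nat.dist (site w) (site w') ≤ r)
    (F : W → Config dim → Config dim → ℂ) (hF : ∀ c, IsCellGate dim cell c (F c))
    (hO : ∀ x y, O x y = ∏ c, F c x y) : IsLocalLayer dim site r O := by
  choose M hM using hF
  exact ⟨cell, hcell, M, fun x y => by simp only [hO, hM]⟩

theorem isCellGate_of_bijective {dim : W → ℕ} {cell : W → W} {c : W} {α : Type*} [Fintype α]
    [DecidableEq α] (M : Matrix.unitaryGroup α ℂ)
    {e : (∀ w : {w : W // cell w = c}, Fin (dim w)) → α} (he : Function.Bijective e) :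
    IsCellGate dim cell c fun x y => (M : Matrix α α ℂ) (e fun w => x w) (e fun w => y w) := by
  refine ⟨⟨(M : Matrix α α ℂ).submatrix (Equiv.ofBijective e he) (Equiv.ofBijective e he),
    Matrix.mem_unitaryGroup_iff'.mpr ?_⟩, fun x y => rfl⟩
  have h : star ((M : Matrix α α ℂ).submatrix (Equiv.ofBijective e he) (Equiv.ofBijective e he))
      = (star (M : Matrix α α ℂ)).submatrix (Equiv.ofBijective e he) (Equiv.ofBijective e he) :=
    rfl
  rw [h, Matrix.submatrix_mul_equiv, Matrix.UnitaryGroup.star_mul_self, Matrix.submatrix_one_equiv]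

theorem isCellGate_empty {dim : W → ℕ} {cell : W → W} {c : W} (hc : ∀ w, cell w ≠ c) :
    IsCellGate dim cell c fun _ _ => 1 := by
  have : IsEmpty {w : W // cell w = c} := ⟨fun w => hc w w.2⟩
  exact ⟨1, fun x y => by
    rw [Matrix.UnitaryGroup.one_val, Subsingleton.elim (fun w : {w : W // cell w = c} => y w)
      (fun w => x w), Matrix.one_apply_eq]⟩

variable {dim : W → ℕ} [∀ w, NeZero (dim w)]

theorem isCellGate_single {cell : W → W} {c a : W} (hc : ∀ w, cell w = c ↔ w = a)
    (M : Matrix.unitaryGroup (Fin (dim a)) ℂ) :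
    IsCellGate dim cell c fun x y => (M : Matrix (Fin (dim a)) (Fin (dim a)) ℂ) (x a) (y a) := by
  refine isCellGate_of_bijective (cell := cell) (c := c) M
    (e := fun x => x ⟨a, (hc a).2 rfl⟩) ⟨fun x y hxy => ?_, fun u => ?_⟩
  · funext ⟨w, hw⟩
    obtain rfl := (hc w).1 hw
    exact hxy
  · exact ⟨fun w => Function.update (0 : Config dim) a u w, by simp⟩

theorem isCellGate_pair {cell : W → W} {c a b : W} (hab : a ≠ b)
    (hc : ∀ w, cell w = c ↔ w = a ∨ w = b)
    (M : Matrix.unitaryGroup (Fin (dim a) × Fin (dim b)) ℂ) :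
    IsCellGate dim cell c fun x y =>
      (M : Matrix (Fin (dim a) × Fin (dim b)) (Fin (dim a) × Fin (dim b)) ℂ)
        (x a, x b) (y a, y b) := by
  refine isCellGate_of_bijective (cell := cell) (c := c) M
    (e := fun x => (x ⟨a, (hc a).2 (.inl rfl)⟩, x ⟨b, (hc b).2 (.inr rfl)⟩))
    ⟨fun x y hxy => ?_, fun ⟨u, v⟩ => ?_⟩
  · funext ⟨w, hw⟩
    obtain ⟨h1, h2⟩ := Prod.mk.inj hxy
    obtain rfl | rfl := (hc w).1 hw
    · exact h1
    · exact h2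
  · exact ⟨fun w => Function.update (Function.update (0 : Config dim) a u) b v w, by simp [hab]⟩

theorem isCellGate_triple {cell : W → W} {c a b e : W} (hab : a ≠ b) (hae : a ≠ e) (hbe : b ≠ e)
    (hc : ∀ w, cell w = c ↔ w = a ∨ w = b ∨ w = e)
    (M : Matrix.unitaryGroup (Fin (dim a) × Fin (dim b) × Fin (dim e)) ℂ) :
    IsCellGate dim cell c fun x y =>
      (M : Matrix (Fin (dim a) × Fin (dim b) × Fin (dim e))
        (Fin (dim a) × Fin (dim b) × Fin (dim e)) ℂ) (x a, x b, x e) (y a, y b, y e) := by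
  refine isCellGate_of_bijective (cell := cell) (c := c) M
    (e := fun x => (x ⟨a, (hc a).2 (.inl rfl)⟩, x ⟨b, (hc b).2 (.inr (.inl rfl))⟩,
      x ⟨e, (hc e).2 (.inr (.inr rfl))⟩)) ⟨fun x y hxy => ?_, fun ⟨u, v, t⟩ => ?_⟩
  · funext ⟨w, hw⟩
    obtain ⟨h1, h23⟩ := Prod.mk.inj hxy
    obtain ⟨h2, h3⟩ := Prod.mk.inj h23
    obtain rfl | rfl | rfl := (hc w).1 hw
    · exact h1
    · exact h2
    · exact h3
  · exact ⟨fun w => Function.update (Function.update (Function.update (0 : Config dim) a u) b v)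
      e t w, by simp [hab, hae, hbe]⟩

end AdaptiveCircuits

namespace MPS

open AdaptiveCircuits

variable {D d p n : ℕ} {G : Type*}

theorem prod_slot {M : Type*} [CommMonoid M] (f : Slot → M) :
    ∏ s, f s = f .left * f .right * f .phys * f .anc := by
  change ∏ s ∈ ({.left, .right, .phys, .anc} : Finset Slot), f s = _
  simp [mul_assoc]

theorem same_eq_one_apply {α : Type} [DecidableEq α] [Fintype α] (a b : α) :
    same a b = ((1 : Matrix.unitaryGroup α ℂ) : Matrix α α ℂ) a b := by
  rw [Matrix.UnitaryGroup.one_val, Matrix.one_apply, same]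

section local_layers

variable [NeZero D] [NeZero d] [NeZero p]

theorem isCellGate_same {cell : Wire n → Wire n} {c a : Wire n} (hc : ∀ w, cell w = c ↔ w = a) :
    IsCellGate (wireDim D d p n) cell c fun x y => same (x a) (y a) := by
  simp only [same_eq_one_apply]
  exact isCellGate_single hc 1

theorem isLocalLayer_bondLayer (K : Matrix.unitaryGroup (Fin D × Fin D) ℂ) :
    IsLocalLayer (wireDim D d p n) (wireSite n) 1 (bondLayer K) := by
  refine isLocalLayer_of_isCellGate
    (fun w => match w with | (i, .right) => (i, .left) | w => w) ?_
    (fun c x y => match c with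
      | (i, .left) => (K : Matrix (Fin D × Fin D) (Fin D × Fin D) ℂ)
          (x (i, .left), x (i, .right)) (y (i, .left), y (i, .right))
      | (_, .right) => 1
      | (i, .phys) => same (x (i, .phys)) (y (i, .phys))
      | (i, .anc) => same (x (i, .anc)) (y (i, .anc))) ?_ ?_
  · rintro ⟨i, s⟩ ⟨j, t⟩ h
    have hij : i = j := by cases s <;> cases t <;> simp_all
    simp [wireSite, hij, Nat.dist_self]
  · rintro ⟨i, s⟩
    cases s
    · exact isCellGate_pair (dim := wireDim D d p n) (a := (i, .left)) (b := (i, .right))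
        (by simp) (by rintro ⟨j, t⟩; cases t <;> simp) K
    · exact isCellGate_empty (by rintro ⟨j, t⟩; cases t <;> simp)
    · exact isCellGate_same (by rintro ⟨j, t⟩; cases t <;> simp)
    · exact isCellGate_same (by rintro ⟨j, t⟩; cases t <;> simp)
  · intro x y
    simp [bondLayer, Fintype.prod_prod_type, prod_slot, mul_assoc]

theorem isLocalLayer_siteLayer (K : Matrix.unitaryGroup (Fin D × Fin d) ℂ) :
    IsLocalLayer (wireDim D d p n) (wireSite n) 1 (siteLayer K) := by
  refine isLocalLayer_of_isCellGate
    (fun w => match w with | (i, .phys) => (i, .left) | w => w) ?_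
    (fun c x y => match c with
      | (i, .left) => (K : Matrix (Fin D × Fin d) (Fin D × Fin d) ℂ)
          (x (i, .left), x (i, .phys)) (y (i, .left), y (i, .phys))
      | (i, .right) => same (x (i, .right)) (y (i, .right))
      | (_, .phys) => 1
      | (i, .anc) => same (x (i, .anc)) (y (i, .anc))) ?_ ?_
  · rintro ⟨i, s⟩ ⟨j, t⟩ h
    have hij : i = j := by cases s <;> cases t <;> simp_all
    simp [wireSite, hij, Nat.dist_self]
  · rintro ⟨i, s⟩
    cases s
    · exact isCellGate_pair (dim := wireDim D d p n) (a := (i, .left)) (b := (i, .phys))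
        (by simp) (by rintro ⟨j, t⟩; cases t <;> simp) K
    · exact isCellGate_same (by rintro ⟨j, t⟩; cases t <;> simp)
    · exact isCellGate_empty (by rintro ⟨j, t⟩; cases t <;> simp)
    · exact isCellGate_same (by rintro ⟨j, t⟩; cases t <;> simp)
  · intro x y
    simp [siteLayer, Fintype.prod_prod_type, prod_slot, mul_assoc]

theorem isLocalLayer_correctionLayer (K : Fin (n + 1) → Matrix.unitaryGroup (Fin d) ℂ)
    (E : Matrix.unitaryGroup (Fin D) ℂ) :
    IsLocalLayer (wireDim D d p n) (wireSite n) 1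
      (correctionLayer (fun i => (K i : Matrix (Fin d) (Fin d) ℂ)) E) := by
  refine isLocalLayer_of_isCellGate id (by rintro w _ rfl; simp [Nat.dist_self])
    (fun c x y => match c with
      | (i, .left) => Fin.cases (motive := fun _ => ℂ)
          ((E : Matrix (Fin D) (Fin D) ℂ) (x (0, .left)) (y (0, .left)))
          (fun j => same (x (j.succ, .left)) (y (j.succ, .left))) i
      | (i, .right) => same (x (i, .right)) (y (i, .right))
      | (i, .phys) => (K i : Matrix (Fin d) (Fin d) ℂ) (x (i, .phys)) (y (i, .phys))
      | (i, .anc) => same (x (i, .anc)) (y (i, .anc))) ?_ ?_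
  · rintro ⟨i, s⟩
    cases s
    · cases i using Fin.cases with
      | zero => exact isCellGate_single (dim := wireDim D d p n) (a := (0, .left)) (by simp) E
      | succ j => exact isCellGate_same (by simp)
    · exact isCellGate_same (by simp)
    · exact isCellGate_single (dim := wireDim D d p n) (a := (i, .phys)) (by simp) (K i)
    · exact isCellGate_same (by simp)
  · intro x y
    simp only [correctionLayer, Matrix.of_apply, Fintype.prod_prod_type, prod_slot,
      Finset.prod_mul_distrib]
    rw [Fin.prod_univ_succ (fun i : Fin (n + 1) => Fin.cases (motive := fun _ => ℂ) _ _ i)]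
    simp only [Fin.cases_zero, Fin.cases_succ]
    ring

theorem isLocalLayer_fusionLayer (K : Matrix.unitaryGroup (Fin D × Fin D × Fin p) ℂ) :
    IsLocalLayer (wireDim D d p n) (wireSite n) 1 (fusionLayer K) := by
  -- the cell of the bond between the sites `j` and `j + 1` is labelled by the right bond of `j`
  refine isLocalLayer_of_isCellGate
    (fun w => match w with
      | (i, .left) => Fin.cases (motive := fun _ => Wire n) (0, .left)
          (fun j => (j.castSucc, .right)) i
      | (i, .anc) => Fin.lastCases (motive := fun _ => Wire n) (Fin.last n, .anc)
          (fun j => (j.castSucc, .right)) i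
      | w => w) ?_
    (fun c x y => match c with
      | (i, .left) => Fin.cases (motive := fun _ => ℂ) (same (x (0, .left)) (y (0, .left)))
          (fun _ => 1) i
      | (i, .right) => Fin.lastCases (motive := fun _ => ℂ)
          (same (x (Fin.last n, .right)) (y (Fin.last n, .right)))
          (fun j => (K : Matrix (Fin D × Fin D × Fin p) (Fin D × Fin D × Fin p) ℂ)
            (x (j.castSucc, .right), x (j.succ, .left), x (j.castSucc, .anc))
            (y (j.castSucc, .right), y (j.succ, .left), y (j.castSucc, .anc))) i
      | (i, .phys) => same (x (i, .phys)) (y (i, .phys))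
      | (i, .anc) => Fin.lastCases (motive := fun _ => ℂ)
          (same (x (Fin.last n, .anc)) (y (Fin.last n, .anc))) (fun _ => 1) i) ?_ ?_
  · have hsite : ∀ w : Wire n, wireSite n w = wireSite n (match w with
        | (i, .left) => Fin.cases (motive := fun _ => Wire n) (0, .left)
            (fun j => (j.castSucc, .right)) i
        | (i, .anc) => Fin.lastCases (motive := fun _ => Wire n) (Fin.last n, .anc)
            (fun j => (j.castSucc, .right)) i
        | w => w) ∨ (wireSite n w = wireSite n (match w with
        | (i, .left) => Fin.cases (motive := fun _ => Wire n) (0, .left)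
            (fun j => (j.castSucc, .right)) i
        | (i, .anc) => Fin.lastCases (motive := fun _ => Wire n) (Fin.last n, .anc)
            (fun j => (j.castSucc, .right)) i
        | w => w) + 1) := by
      rintro ⟨i, s⟩
      cases s
      · cases i using Fin.cases <;> simp [wireSite]
      · simp
      · simp
      · cases i using Fin.lastCases <;> simp [wireSite]
    intro w w' h
    have h1 := hsite w
    have h2 := hsite w'
    rw [h] at h1
    simp only [Nat.dist]
    omega
  · rintro ⟨i, s⟩
    cases s
    · cases i using Fin.cases with
      | zero =>
        refine isCellGate_same (a := (0, .left)) ?_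
        rintro ⟨j, t⟩
        cases t
        · cases j using Fin.cases <;> simp
        · simp
        · simp
        · cases j using Fin.lastCases <;> simp
      | succ k =>
        refine isCellGate_empty ?_
        rintro ⟨j, t⟩
        cases t
        · cases j using Fin.cases <;> simp [(Fin.succ_ne_zero _).symm]
        · simp
        · simp
        · cases j using Fin.lastCases <;> simp
    · cases i using Fin.lastCases with
      | last =>
        simp only [Fin.lastCases_last]
        refine isCellGate_same (a := (Fin.last n, .right)) ?_
        rintro ⟨j, t⟩
        cases t
        · cases j using Fin.cases <;> simp [Fin.castSucc_ne_last]
        · simp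
        · simp
        · cases j using Fin.lastCases <;> simp [Fin.castSucc_ne_last]
      | cast k =>
        simp only [Fin.lastCases_castSucc]
        refine isCellGate_triple (dim := wireDim D d p n) (a := (k.castSucc, .right))
          (b := (k.succ, .left)) (e := (k.castSucc, .anc)) (by simp) (by simp) (by simp) ?_ K
        rintro ⟨j, t⟩
        cases t
        · cases j using Fin.cases <;> simp [(Fin.succ_ne_zero _).symm]
        · simp
        · simp
        · cases j using Fin.lastCases <;> simp [(Fin.castSucc_ne_last _).symm]
    · refine isCellGate_same ?_
      rintro ⟨j, t⟩
      cases t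
      · cases j using Fin.cases <;> simp
      · simp
      · simp
      · cases j using Fin.lastCases <;> simp
    · cases i using Fin.lastCases with
      | last =>
        simp only [Fin.lastCases_last]
        refine isCellGate_same (a := (Fin.last n, .anc)) ?_
        rintro ⟨j, t⟩
        cases t
        · cases j using Fin.cases <;> simp
        · simp
        · simp
        · cases j using Fin.lastCases <;> simp [Fin.castSucc_ne_last]
      | cast k =>
        simp only [Fin.lastCases_castSucc]
        refine isCellGate_empty ?_
        rintro ⟨j, t⟩
        cases t
        · cases j using Fin.cases <;> simp
        · simp
        · simp
        · cases j using Fin.lastCases <;> simp [(Fin.castSucc_ne_last _).symm]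
  · intro x y
    simp only [fusionLayer, Matrix.of_apply, Fintype.prod_prod_type, prod_slot,
      Finset.prod_mul_distrib]
    rw [Fin.prod_univ_succ (fun i : Fin (n + 1) => Fin.cases (motive := fun _ => ℂ) _ _ i),
      Fin.prod_univ_castSucc (fun i : Fin (n + 1) => Fin.lastCases (motive := fun _ => ℂ)
        (same (x (Fin.last n, .right)) (y (Fin.last n, .right))) _ i),
      Fin.prod_univ_castSucc (fun i : Fin (n + 1) => Fin.lastCases (motive := fun _ => ℂ)
        (same (x (Fin.last n, .anc)) (y (Fin.last n, .anc))) _ i)]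
    simp only [Fin.cases_zero, Fin.cases_succ, Fin.lastCases_last, Fin.lastCases_castSucc,
      Finset.prod_const_one]
    ring

end local_layers

/-! ### Existence of the gates -/

/-- Orthonormal columns complete to a unitary matrix. -/
theorem exists_unitary_extending {ι κ : Type*} [Fintype ι] [DecidableEq ι] [Fintype κ]
    [DecidableEq κ] (f : κ ↪ ι) (C : Matrix ι κ ℂ) (hC : Cᴴ * C = 1) :
    ∃ W : Matrix.unitaryGroup ι ℂ, ∀ i k, (W : Matrix ι ι ℂ) i (f k) = C i k := by
  have hinner : ∀ k l, inner ℂ (WithLp.toLp 2 fun i => C i k : EuclideanSpace ℂ ι)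
      (WithLp.toLp 2 fun i => C i l) = if k = l then 1 else 0 := by
    intro k l
    have := congrFun (congrFun hC k) l
    rw [Matrix.mul_apply, Matrix.one_apply] at this
    rw [← this, PiLp.inner_apply]
    exact Finset.sum_congr rfl fun i _ => by simp [mul_comm]
  let v : ι → EuclideanSpace ℂ ι := fun j =>
    open Classical in if h : ∃ k, f k = j then WithLp.toLp 2 fun i => C i h.choose else 0
  have hv : ∀ k, v (f k) = WithLp.toLp 2 fun i => C i k := by
    intro k
    have h : ∃ k', f k' = f k := ⟨k, rfl⟩
    have hk : h.choose = k := f.injective h.choose_spec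
    simp only [v, dif_pos h, hk]
  have horth : Orthonormal ℂ ((Set.range f).domRestrict v) := by
    rw [orthonormal_iff_ite]
    intro i j
    obtain ⟨k, hk⟩ := i.2
    obtain ⟨l, hl⟩ := j.2
    change inner ℂ (v i) (v j) = _
    have hij : i = j ↔ k = l := by rw [Subtype.ext_iff, ← hk, ← hl, f.injective.eq_iff]
    simp only [← hk, ← hl, hv, hinner, hij]
  obtain ⟨b, hb⟩ := horth.exists_orthonormalBasis_extension_of_card_eq (by simp)
  refine ⟨⟨Matrix.of fun i j => b j i, Matrix.mem_unitaryGroup_iff'.mpr ?_⟩, fun i k => ?_⟩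
  · ext j k
    have := orthonormal_iff_ite.mp b.orthonormal j k
    rw [Matrix.mul_apply, Matrix.one_apply, ← this, PiLp.inner_apply]
    exact Finset.sum_congr rfl fun i _ => by simp [Matrix.star_apply, mul_comm]
  · change b (f k) i = C i k
    rw [hb _ ⟨k, rfl⟩, hv]

/-- The ancilla dimension is chosen so that the code space has dimension `lcm(|G|, D²)`. -/
theorem card_le_card_code [Fintype G] [Nonempty G] [NeZero D] :
    Fintype.card G ≤ Fintype.card (Fin D × Fin D × Fin (ancillaDim D G)) := by
  have hD : 0 < D ^ 2 := pow_pos (Nat.pos_of_ne_zero (NeZero.ne D)) 2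
  have h1 : Fintype.card (Fin D × Fin D × Fin (ancillaDim D G))
      = Nat.lcm (Fintype.card G) (D ^ 2) := by
    rw [Fintype.card_prod, Fintype.card_prod, Fintype.card_fin, Fintype.card_fin, ← mul_assoc,
      ← pow_two, ancillaDim]
    exact Nat.mul_div_cancel' (Nat.dvd_lcm_right _ _)
  rw [h1]
  exact Nat.le_of_dvd (Nat.lcm_pos Fintype.card_pos hD) (Nat.dvd_lcm_left _ _)

theorem nonempty_protocolGates [Group G] [Fintype G] [NeZero D] [NeZero d]
    {A : Fin d → Matrix (Fin D) (Fin D) ℂ} (hcan : LeftCanonical A)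
    {B : G → Matrix.unitaryGroup (Fin D) ℂ} (hB : IsPOVM B) : Nonempty (ProtocolGates A B) := by
  obtain ⟨bond, hbond⟩ := exists_unitary_extending (κ := Unit) (ι := Fin D × Fin D)
    ⟨fun _ => (0, 0), fun _ _ _ => rfl⟩
    (Matrix.of fun lr _ => if lr.1 = lr.2 then ((1 / √(D : ℝ) : ℝ) : ℂ) else 0) (by
      ext
      simp only [Matrix.mul_apply, conjTranspose_apply, Matrix.of_apply, Fintype.sum_prod_type]
      have hD : (D : ℝ) ≠ 0 := Nat.cast_ne_zero.mpr (NeZero.ne D)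
      have : (D : ℝ) * ((1 / √(D : ℝ)) * (1 / √(D : ℝ))) = 1 := by
        rw [div_mul_div_comm, Real.mul_self_sqrt (Nat.cast_nonneg _)]
        field_simp
      have h2 := congrArg Complex.ofReal this
      rw [Complex.ofReal_mul, Complex.ofReal_mul, Complex.ofReal_natCast] at h2
      have h3 : star ((1 / √(D : ℝ) : ℝ) : ℂ) = ((1 / √(D : ℝ) : ℝ) : ℂ) := Complex.conj_ofReal _
      rw [Matrix.one_apply_eq]
      calc _ = ∑ l : Fin D, ((1 / √(D : ℝ) : ℝ) : ℂ) * ((1 / √(D : ℝ) : ℝ) : ℂ) := by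
            refine Finset.sum_congr rfl fun l _ => ?_
            rw [Finset.sum_eq_single l]
            · simp only [if_true, h3]
            · intro b _ hb; simp [Ne.symm hb]
            · simp
        _ = _ := by rw [Finset.sum_const, Finset.card_univ, Fintype.card_fin, nsmul_eq_mul, h2,
                      Complex.ofReal_one])
  obtain ⟨site, hsite⟩ := exists_unitary_extending (κ := Fin D) (ι := Fin D × Fin d)
    ⟨fun j => (j, 0), fun _ _ h => (Prod.mk.inj h).1⟩
    (Matrix.of fun im j => A im.2 im.1 j) (by
      rw [← hcan]
      ext j k
      simp only [Matrix.mul_apply, conjTranspose_apply, Matrix.of_apply, Fintype.sum_prod_type,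
        Matrix.sum_apply]
      exact Finset.sum_comm)
  obtain ⟨code⟩ := Function.Embedding.nonempty_of_card_le (card_le_card_code (D := D) (G := G))
  obtain ⟨fusion, hfusion⟩ := exists_unitary_extending (κ := Fin D × Fin D)
    (ι := Fin D × Fin D × Fin (ancillaDim D G))
    ⟨fun ij => (ij.1, ij.2, 0), fun _ _ h => by
      obtain ⟨h1, h2⟩ := Prod.mk.inj h
      exact Prod.ext h1 (Prod.mk.inj h2).1⟩
    (Matrix.of fun k ij => ∑ g, if code g = k then fusionMap B g ij else 0) (by
      rw [← hB]
      ext ij kl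
      simp only [Matrix.mul_apply, conjTranspose_apply, Matrix.of_apply, star_sum,
        Finset.sum_mul_sum]
      rw [Finset.sum_comm]
      refine Finset.sum_congr rfl fun g _ => ?_
      rw [Finset.sum_comm, Finset.sum_eq_single g]
      · rw [Finset.sum_eq_single (code g)]
        · simp
        · intro k _ hk; simp [Ne.symm hk]
        · simp
      · intro g' _ hg'
        refine Finset.sum_eq_zero fun k _ => ?_
        by_cases hk : code g = k
        · subst hk; simp [hg']
        · simp [hk]
      · simp)
  exact ⟨{
    bond := bond
    bond_spec := fun l r => hbond (l, r) ()
    site := site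
    site_spec := fun i j m => hsite (i, m) j
    code := code
    fusion := fusion
    fusion_spec := fun g i j => (hfusion (code g) (i, j)).trans (by
      rw [Matrix.of_apply, Finset.sum_eq_single g]
      · simp
      · intro g' _ hg'; exact if_neg fun h => hg' (code.injective h)
      · simp)
    fusion_zero := fun k i j hk => (hfusion k (i, j)).trans (by
      refine Finset.sum_eq_zero fun g _ => if_neg fun h => hk ⟨g, h⟩) }⟩

/-! ### Words with defects -/

/-- A word `A^{m_0} W_0 A^{m_1} W_1 ⋯ A^{m_n}` with a defect on each internal bond. -/
def defectWord (A : Fin d → Matrix (Fin D) (Fin D) ℂ) : {n : ℕ} →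
    (Fin n → Matrix (Fin D) (Fin D) ℂ) → (Fin (n + 1) → Fin d) → Matrix (Fin D) (Fin D) ℂ
  | 0, _, m => A (m 0)
  | _ + 1, W, m => A (m 0) * (W 0 * defectWord A (Fin.tail W) (Fin.tail m))

/-- All defects are moved to the left edge, where their product acts: the on-site unitaries are
found from right to left, each of them moving the product of the defects to its right through one
site. -/
theorem exists_correction {A : Fin d → Matrix (Fin D) (Fin D) ℂ}
    (W : Fin n → Matrix.unitaryGroup (Fin D) ℂ) (hW : ∀ i, Pushable A (W i)) :
    ∃ (K : Fin (n + 1) → Matrix.unitaryGroup (Fin d) ℂ) (Q : Matrix.unitaryGroup (Fin D) ℂ),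
      Pushable A Q ∧ ∀ m : Fin (n + 1) → Fin d,
        ∑ m' : Fin (n + 1) → Fin d, (∏ i, (K i : Matrix (Fin d) (Fin d) ℂ) (m i) (m' i))
          • defectWord A (fun i => (W i : Matrix (Fin D) (Fin D) ℂ)) m'
          = (Q : Matrix (Fin D) (Fin D) ℂ) * word A m := by
  induction n with
  | zero =>
    refine ⟨fun _ => 1, 1, pushable_one A, fun m => ?_⟩
    rw [← (Fin.consEquiv fun _ => Fin d).sum_comp, Fintype.sum_prod_type]
    simp [defectWord, word, Fin.consEquiv, Matrix.one_apply]
  | succ n ih =>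
    obtain ⟨K, Q, ⟨O, hO⟩, hK⟩ := ih (Fin.tail W) fun i => hW i.succ
    obtain ⟨O, hO⟩ := (hW 0).mul ⟨O, hO⟩
    refine ⟨Fin.cons O K, W 0 * Q, ⟨O, hO⟩, fun m => ?_⟩
    rw [word_succ, ← Matrix.mul_assoc, ← hO, Matrix.mul_assoc, Matrix.UnitaryGroup.mul_val,
      Matrix.mul_assoc, ← hK, ← (Fin.consEquiv fun _ => Fin d).sum_comp, Fintype.sum_prod_type, act,
      Finset.sum_mul]
    refine Finset.sum_congr rfl fun a _ => ?_
    rw [Finset.mul_sum, Finset.mul_sum]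
    refine Finset.sum_congr rfl fun m' _ => ?_
    simp only [Fin.consEquiv, Equiv.coe_fn_mk, Fin.prod_univ_succ, Fin.cons_zero, Fin.cons_succ,
      defectWord, Fin.tail_cons, mul_smul_comm, smul_mul_assoc, smul_smul]
    rw [mul_comm]
    rfl

/-- Contraction of the bond indices of a chain of tensors and defects. -/
theorem sum_bonds_eq_defectWord (A : Fin d → Matrix (Fin D) (Fin D) ℂ)
    (W : Fin n → Matrix (Fin D) (Fin D) ℂ) (m : Fin (n + 1) → Fin d) (a b : Fin D) :
    ∑ l : Fin (n + 1) → Fin D, ∑ r : Fin (n + 1) → Fin D,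
      (∏ i : Fin n, W i (r i.castSucc) (l i.succ)) * same a (l 0) * same b (r (Fin.last n))
        * ∏ i, A (m i) (l i) (r i) = defectWord A W m a b := by
  induction n generalizing a with
  | zero =>
    simp only [← (Fin.consEquiv fun _ => Fin D).sum_comp, Fintype.sum_prod_type]
    simp [defectWord, same, Fin.consEquiv, ite_mul]
  | succ n ih =>
    have hsplit : ∀ f : (Fin (n + 2) → Fin D) → ℂ, ∑ l, f l = ∑ x, ∑ l, f (Fin.cons x l) := by
      intro f
      rw [← (Fin.consEquiv fun _ => Fin D).sum_comp, Fintype.sum_prod_type]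
      rfl
    simp only [hsplit]
    have hins : ∀ (x : Fin D) (l : Fin (n + 1) → Fin D),
        W 0 x (l 0) = ∑ y, W 0 x y * same y (l 0) := by
      intro x l; simp [same]
    calc _ = ∑ x, ∑ x', same a x * A (m 0) x x' * ∑ y, W 0 x' y *
          ∑ l : Fin (n + 1) → Fin D, ∑ r : Fin (n + 1) → Fin D,
          (∏ i : Fin n, Fin.tail W i (r i.castSucc) (l i.succ)) * same y (l 0)
            * same b (r (Fin.last n)) * ∏ i, A (Fin.tail m i) (l i) (r i) := by
          refine Finset.sum_congr rfl fun x _ => ?_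
          rw [Finset.sum_comm]
          refine Finset.sum_congr rfl fun x' _ => ?_
          simp only [Finset.mul_sum]
          conv_rhs => rw [Finset.sum_comm]
          refine Finset.sum_congr rfl fun l _ => ?_
          conv_rhs => rw [Finset.sum_comm]
          refine Finset.sum_congr rfl fun r _ => ?_
          simp only [Fin.prod_univ_succ (n := n), Fin.prod_univ_succ (n := n + 1), Fin.cons_zero,
            Fin.cons_succ, Fin.castSucc_zero, ← Fin.succ_last, hins, ← Fin.succ_castSucc]
          simp only [Finset.sum_mul]
          refine Finset.sum_congr rfl fun y _ => ?_
          simp only [Fin.tail]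
          ring
      _ = _ := by
          simp only [ih]
          rw [defectWord, Matrix.mul_apply, Finset.sum_eq_single a]
          · refine Finset.sum_congr rfl fun x' _ => ?_
            rw [Matrix.mul_apply]
            simp [same]
          · intro x _ hx; simp [same, Ne.symm hx]
          · simp

/-! ### The state during the protocol -/

/-- The basis state of the register with given values on the left bonds, the right bonds, the
physical qudits and the ancillas. -/
def chainConfig (l r : Fin (n + 1) → Fin D) (m : Fin (n + 1) → Fin d) (a : Fin (n + 1) → Fin p) :
    ChainConfig D d p n
  | (i, .left) => l i
  | (i, .right) => r i
  | (i, .phys) => m i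
  | (i, .anc) => a i

/-- Basis states of the register are quadruples of basis states of the four kinds of qudits. -/
def chainConfigEquiv (D d p n : ℕ) :
    ((Fin (n + 1) → Fin D) × (Fin (n + 1) → Fin D) × (Fin (n + 1) → Fin d) × (Fin (n + 1) → Fin p))
      ≃ ChainConfig D d p n where
  toFun q := chainConfig q.1 q.2.1 q.2.2.1 q.2.2.2
  invFun x := (fun i => x (i, .left), fun i => x (i, .right), fun i => x (i, .phys),
    fun i => x (i, .anc))
  left_inv _ := rfl
  right_inv x := by
    funext ⟨i, s⟩
    cases s <;> rfl

theorem sum_chainConfig (f : ChainConfig D d p n → ℂ) :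
    ∑ y, f y = ∑ l, ∑ r, ∑ m, ∑ a, f (chainConfig l r m a) := by
  rw [← (chainConfigEquiv D d p n).sum_comp]
  simp only [Fintype.sum_prod_type]
  rfl

theorem sum_pi_prod {ι κ : Type*} [Fintype ι] [DecidableEq ι] [Fintype κ] (F : ι → κ → ℂ) :
    ∑ f : ι → κ, ∏ i, F i (f i) = ∏ i, ∑ k, F i k := by
  rw [Finset.prod_univ_sum, Fintype.piFinset_univ]

theorem sum_prod_chainConfig (F : Fin (n + 1) → Fin D → Fin D → Fin d → Fin p → ℂ) :
    ∑ y : ChainConfig D d p n,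
      ∏ i, F i (y (i, .left)) (y (i, .right)) (y (i, .phys)) (y (i, .anc))
      = ∏ i, ∑ l, ∑ r, ∑ m, ∑ a, F i l r m a := by
  rw [sum_chainConfig, ← sum_pi_prod (fun i l => ∑ r, ∑ m, ∑ a, F i l r m a)]
  refine Finset.sum_congr rfl fun l _ => ?_
  rw [← sum_pi_prod (fun i r => ∑ m, ∑ a, F i (l i) r m a)]
  refine Finset.sum_congr rfl fun r _ => ?_
  rw [← sum_pi_prod (fun i m => ∑ a, F i (l i) (r i) m a)]
  refine Finset.sum_congr rfl fun m _ => ?_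
  exact sum_pi_prod (fun i a => F i (l i) (r i) (m i) a)

theorem prod_same {ι α : Type} [Fintype ι] [DecidableEq α] (f g : ι → α) :
    ∏ i, same (f i) (g i) = if f = g then 1 else 0 := by
  simp only [same]
  rw [Finset.prod_ite_zero]
  simp [funext_iff]

theorem sum_prod_same_mul {ι α : Type} [Fintype ι] [DecidableEq ι] [Fintype α] [DecidableEq α]
    (f : ι → α) (h : (ι → α) → ℂ) : ∑ g : ι → α, (∏ i, same (f i) (g i)) * h g = h f := by
  simp [prod_same]

section evolution

variable [NeZero D] [NeZero d] [Group G] [Fintype G] {A : Fin d → Matrix (Fin D) (Fin D) ℂ}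
  {B : G → Matrix.unitaryGroup (Fin D) ℂ}

/-- After the preparation steps the register is in a product of single-site states with entangled
boundary conditions. -/
theorem siteLayer_bondLayer_mulVec (P : ProtocolGates A B)
    (x : ChainConfig D d (ancillaDim D G) n) :
    ((siteLayer P.site : Matrix (ChainConfig D d (ancillaDim D G) n) _ ℂ) *ᵥ
      (bondLayer P.bond *ᵥ zeroState (wireDim D d (ancillaDim D G) n))) x
      = ∏ i, (((1 / √(D : ℝ) : ℝ) : ℂ) * A (x (i, .phys)) (x (i, .left)) (x (i, .right))
          * same (x (i, .anc)) (0 : Fin (ancillaDim D G))) := by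
  have h1 : ∀ y : ChainConfig D d (ancillaDim D G) n,
      ((bondLayer P.bond : Matrix (ChainConfig D d (ancillaDim D G) n) _ ℂ) *ᵥ
        zeroState (wireDim D d (ancillaDim D G) n)) y
      = ∏ i, ((P.bond : Matrix (Fin D × Fin D) (Fin D × Fin D) ℂ)
          (y (i, .left), y (i, .right)) (0, 0) * same (y (i, .phys)) 0
            * same (y (i, .anc)) (0 : Fin (ancillaDim D G))) := by
    intro y
    simp only [Matrix.mulVec, dotProduct, zeroState, mul_ite, mul_one, mul_zero,
      Finset.sum_ite_eq', Finset.mem_univ, if_true]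
    rfl
  rw [Matrix.mulVec, dotProduct]
  simp only [h1, siteLayer, Matrix.of_apply, ← Finset.prod_mul_distrib]
  refine (sum_prod_chainConfig (fun i l r m a =>
    (P.site : Matrix (Fin D × Fin d) (Fin D × Fin d) ℂ) (x (i, .left), x (i, .phys)) (l, m)
      * same (x (i, .right)) r * same (x (i, .anc)) a
      * ((P.bond : Matrix (Fin D × Fin D) (Fin D × Fin D) ℂ) (l, r) (0, 0)
        * same m 0 * same a (0 : Fin (ancillaDim D G))))).trans ?_
  refine Finset.prod_congr rfl fun i _ => ?_
  simp only [P.bond_spec]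
  have hcollapse : ∀ (f : Fin D → Fin d → ℂ) (r₀ : Fin D) (a₀ : Fin (ancillaDim D G)) (s : ℂ),
      ∑ l, ∑ r, ∑ m, ∑ a, f l m * same r₀ r * same a₀ a
        * ((if l = r then s else 0) * same m 0 * same a 0) = s * f r₀ 0 * same a₀ 0 := by
    intro f r₀ a₀ s
    rw [Finset.sum_eq_single r₀, Finset.sum_eq_single r₀, Finset.sum_eq_single 0,
      Finset.sum_eq_single a₀]
    · simp [same, mul_comm]
    all_goals simp +contextual [same, eq_comm]
  refine (hcollapse _ _ _ _).trans ?_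
  rw [P.site_spec]

/-- The outcome of the fusion of the sites `i` and `i + 1`. -/
def fusionOutcome (x : ChainConfig D d p n) (i : Fin n) : Fin D × Fin D × Fin p :=
  (x (i.castSucc, .right), x (i.succ, .left), x (i.castSucc, .anc))

/-- Every outcome of the fusion measurement inserts a multiple of a defect: the multiple is zero
for the outcomes that do not encode a defect. -/
theorem exists_fusion_eq_smul (P : ProtocolGates A B) (k : Fin D × Fin D × Fin (ancillaDim D G)) :
    ∃ (t : ℂ) (g : G), ∀ r l, (P.fusion : Matrix (Fin D × Fin D × Fin (ancillaDim D G))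
      (Fin D × Fin D × Fin (ancillaDim D G)) ℂ) k (r, l, 0)
      = t * (B g : Matrix (Fin D) (Fin D) ℂ) r l := by
  by_cases hk : k ∈ Set.range P.code
  · obtain ⟨g, rfl⟩ := hk
    exact ⟨_, g, fun r l => P.fusion_spec g r l⟩
  · exact ⟨0, 1, fun r l => by rw [P.fusion_zero k r l hk, zero_mul]⟩

/-- The state before the measurement, for given defects `g k` and amplitudes `t k` of the fusion
outcomes `k`. -/
theorem fusionLayer_mulVec (P : ProtocolGates A B)
    {t : Fin D × Fin D × Fin (ancillaDim D G) → ℂ} {g : Fin D × Fin D × Fin (ancillaDim D G) → G}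
    (ht : ∀ k r l, (P.fusion : Matrix (Fin D × Fin D × Fin (ancillaDim D G))
      (Fin D × Fin D × Fin (ancillaDim D G)) ℂ) k (r, l, 0)
      = t k * (B (g k) : Matrix (Fin D) (Fin D) ℂ) r l)
    (x : ChainConfig D d (ancillaDim D G) n) :
    ((fusionLayer P.fusion : Matrix (ChainConfig D d (ancillaDim D G) n) _ ℂ) *ᵥ
      (siteLayer P.site *ᵥ (bondLayer P.bond *ᵥ zeroState (wireDim D d (ancillaDim D G) n)))) x
      = ((1 / √(D : ℝ) : ℝ) : ℂ) ^ (n + 1) * same (x (Fin.last n, .anc)) 0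
        * (∏ i, t (fusionOutcome x i))
        * defectWord A (fun i => (B (g (fusionOutcome x i)) : Matrix (Fin D) (Fin D) ℂ))
          (fun i => x (i, .phys)) (x (0, .left)) (x (Fin.last n, .right)) := by
  set s : ℂ := ((1 / √(D : ℝ) : ℝ) : ℂ)
  set F : Matrix (Fin D × Fin D × Fin (ancillaDim D G))
      (Fin D × Fin D × Fin (ancillaDim D G)) ℂ := P.fusion.1
  rw [Matrix.mulVec, dotProduct]
  simp only [siteLayer_bondLayer_mulVec]
  rw [sum_chainConfig]
  calc _ = ∑ l : Fin (n + 1) → Fin D, ∑ r : Fin (n + 1) → Fin D,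
        ∑ m : Fin (n + 1) → Fin d, (∏ i, same (x (i, .phys)) (m i)) *
          ∑ a : Fin (n + 1) → Fin (ancillaDim D G), (∏ i, same (0 : Fin (ancillaDim D G)) (a i)) *
          ((∏ i : Fin n, F (fusionOutcome x i) (r i.castSucc, l i.succ, a i.castSucc))
            * same (x (0, .left)) (l 0) * same (x (Fin.last n, .right)) (r (Fin.last n))
            * same (x (Fin.last n, .anc)) (a (Fin.last n))
            * (s ^ (n + 1) * ∏ i, A (m i) (l i) (r i))) := by
        refine Finset.sum_congr rfl fun l _ => Finset.sum_congr rfl fun r _ =>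
          Finset.sum_congr rfl fun m _ => ?_
        rw [Finset.mul_sum]
        refine Finset.sum_congr rfl fun a _ => ?_
        have hp : ∏ i, (s * A (m i) (l i) (r i) * same (a i) 0) = s ^ (n + 1)
            * (∏ i, A (m i) (l i) (r i)) * ∏ i, same (0 : Fin (ancillaDim D G)) (a i) := by
          rw [Finset.prod_mul_distrib, Finset.prod_mul_distrib, Finset.prod_const,
            Finset.card_univ, Fintype.card_fin]
          congr 1
          exact Finset.prod_congr rfl fun i _ => by simp [same, eq_comm]
        refine (congrArg _ hp).trans ?_
        simp only [fusionLayer, Matrix.of_apply, chainConfig, fusionOutcome]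
        ring
    _ = ∑ l : Fin (n + 1) → Fin D, ∑ r : Fin (n + 1) → Fin D,
          s ^ (n + 1) * same (x (Fin.last n, .anc)) 0 * (∏ i, t (fusionOutcome x i)) *
          ((∏ i : Fin n, (B (g (fusionOutcome x i)) : Matrix (Fin D) (Fin D) ℂ)
              (r i.castSucc) (l i.succ))
            * same (x (0, .left)) (l 0) * same (x (Fin.last n, .right)) (r (Fin.last n))
            * ∏ i, A (x (i, .phys)) (l i) (r i)) := by
        refine Finset.sum_congr rfl fun l _ => Finset.sum_congr rfl fun r _ => ?_
        refine (sum_prod_same_mul _ _).trans ?_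
        refine (sum_prod_same_mul _ _).trans ?_
        simp only [ht, Finset.prod_mul_distrib]
        ring
    _ = _ := by
        rw [← sum_bonds_eq_defectWord]
        simp only [Finset.mul_sum]

end evolution

/-- The action of the feedforward layer. -/
theorem correctionLayer_mulVec (K : Fin (n + 1) → Matrix (Fin d) (Fin d) ℂ)
    (E : Matrix (Fin D) (Fin D) ℂ) (ψ : ChainConfig D d p n → ℂ) (x : ChainConfig D d p n) :
    ((correctionLayer K E : Matrix (ChainConfig D d p n) _ ℂ) *ᵥ ψ) x
      = ∑ l₀ : Fin D, ∑ m : Fin (n + 1) → Fin d, E (x (0, .left)) l₀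
        * (∏ i, K i (x (i, .phys)) (m i))
        * ψ (chainConfig (Fin.cons l₀ fun i => x (i.succ, .left)) (fun i => x (i, .right)) m
            (fun i => x (i, .anc))) := by
  rw [Matrix.mulVec, dotProduct, sum_chainConfig, ← (Fin.consEquiv fun _ => Fin D).sum_comp,
    Fintype.sum_prod_type]
  refine Finset.sum_congr rfl fun l₀ _ => ?_
  calc _ = ∑ l : Fin n → Fin D, (∏ i, same (x (i.succ, .left)) (l i))
        * ∑ r : Fin (n + 1) → Fin D, (∏ i, same (x (i, .right)) (r i))
        * ∑ m : Fin (n + 1) → Fin d, ∑ a : Fin (n + 1) → Fin p, (∏ i, same (x (i, .anc)) (a i))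
        * (E (x (0, .left)) l₀ * (∏ i, K i (x (i, .phys)) (m i))
          * ψ (chainConfig (Fin.cons l₀ l) r m a)) := by
        refine Finset.sum_congr rfl fun l _ => ?_
        rw [Finset.mul_sum]
        refine Finset.sum_congr rfl fun r _ => ?_
        rw [Finset.mul_sum, Finset.mul_sum]
        refine Finset.sum_congr rfl fun m _ => ?_
        rw [Finset.mul_sum, Finset.mul_sum]
        refine Finset.sum_congr rfl fun a _ => ?_
        simp only [correctionLayer, Matrix.of_apply, chainConfig, Fin.consEquiv, Equiv.coe_fn_mk,
          Fin.cons_zero, Fin.cons_succ, Finset.prod_mul_distrib]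
        ring
    _ = _ := by
        refine (sum_prod_same_mul _ _).trans ((sum_prod_same_mul _ _).trans ?_)
        exact Finset.sum_congr rfl fun m _ => sum_prod_same_mul _ _

/-! ### Deterministic preparation -/

theorem notMem_outputWires_of_mem {w : Wire n} (hw : w ∈ measuredWires n) :
    w ∉ outputWires n := by
  obtain ⟨i, s⟩ := w
  cases s <;> simp_all [measuredWires, outputWires]

theorem last_anc_notMem_outputWires : ((Fin.last n, .anc) : Wire n) ∉ outputWires n := by
  simp [outputWires]

/-- The protocol works for any POVM of defects that on-site unitaries can move through a site. For
outcomes that encode no defect the final state vanishes, and then so does the state `χ` of the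
qudits that are not part of the output. -/
theorem preparedByProtocol_of_pushable [NeZero D] [NeZero d] [Group G] [Fintype G]
    {A : Fin d → Matrix (Fin D) (Fin D) ℂ} {B : G → Matrix.unitaryGroup (Fin D) ℂ}
    (hcan : LeftCanonical A) (hB : IsPOVM B) (hpush : ∀ g, Pushable A (B g)) :
    PreparedByProtocol A B := by
  obtain ⟨P⟩ := nonempty_protocolGates hcan hB
  choose t g ht using exists_fusion_eq_smul P
  refine ⟨P, fun n => ?_⟩
  -- the fusion outcomes, read off from the outcomes on the individual qudits
  let out : Outcome D d (ancillaDim D G) n → Fin n → Fin D × Fin D × Fin (ancillaDim D G) :=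
    fun o i => (o ⟨(i.castSucc, .right), by simp [measuredWires, Fin.castSucc_ne_last]⟩,
      o ⟨(i.succ, .left), by simp [measuredWires]⟩,
      o ⟨(i.castSucc, .anc), by simp [measuredWires, Fin.castSucc_ne_last]⟩)
  choose K Q hQ hK using fun o => exists_correction (fun i => B (g (out o i)))
    fun i => hpush (g (out o i))
  refine ⟨K, fun o => (Q o)⁻¹, fun _ => trivial, ⟨isLocalLayer_bondLayer _,
    isLocalLayer_siteLayer _, isLocalLayer_fusionLayer _, fun o => ⟨isLocalLayer_correctionLayer _ _, ⟨⟩⟩⟩, ?_⟩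
  intro φ hφ
  obtain ⟨o, rfl⟩ : ∃ o, φ = (correctionLayer (fun i => (K o i : Matrix (Fin d) (Fin d) ℂ))
      ((Q o)⁻¹ : Matrix.unitaryGroup (Fin D) ℂ) : Matrix (ChainConfig D d (ancillaDim D G) n) _ ℂ)
      *ᵥ collapse (measuredWires n) o ((fusionLayer P.fusion :
        Matrix (ChainConfig D d (ancillaDim D G) n) _ ℂ) *ᵥ
      (siteLayer P.site *ᵥ (bondLayer P.bond *ᵥ zeroState (wireDim D d (ancillaDim D G) n)))) := by
    exact Set.mem_iUnion.mp hφ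
  set s : ℂ := ((1 / √(D : ℝ) : ℝ) : ℂ) with hs
  refine ⟨open Classical in fun z =>
    if ∀ w : {w : Wire n // w ∈ measuredWires n}, z ⟨w, notMem_outputWires_of_mem w.2⟩ = o w
    then s ^ n * same (z ⟨(Fin.last n, .anc), last_anc_notMem_outputWires⟩) 0
      * ∏ i, t (out o i) else 0, fun x => ?_⟩
  rw [correctionLayer_mulVec]
  -- the outcome condition does not involve the qudits on which the corrections act
  have hcond : ∀ (l₀ : Fin D) (m : Fin (n + 1) → Fin d)
      (w : {w : Wire n // w ∈ measuredWires n}),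
      (chainConfig (Fin.cons l₀ fun i => x (i.succ, .left)) (fun i => x (i, .right)) m
        (fun i => x (i, .anc)) : ChainConfig D d (ancillaDim D G) n) w = x w := by
    rintro l₀ m ⟨⟨i, σ⟩, hw⟩
    cases σ
    · cases i using Fin.cases with
      | zero => simp [measuredWires] at hw
      | succ j => rfl
    · rfl
    · simp [measuredWires] at hw
    · rfl
  by_cases hx : ∀ w : {w : Wire n // w ∈ measuredWires n}, x w = o w
  · have hout : fusionOutcome x = out o := by
      funext i
      simp only [fusionOutcome, out]
      rw [← hx, ← hx, ← hx]
    have hterm : ∀ (l₀ : Fin D) (m : Fin (n + 1) → Fin d),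
        collapse (measuredWires n) o ((fusionLayer P.fusion :
          Matrix (ChainConfig D d (ancillaDim D G) n) _ ℂ) *ᵥ
          (siteLayer P.site *ᵥ (bondLayer P.bond *ᵥ zeroState (wireDim D d (ancillaDim D G) n))))
          (chainConfig (Fin.cons l₀ fun i => x (i.succ, .left)) (fun i => x (i, .right)) m
            (fun i => x (i, .anc)))
        = s ^ (n + 1) * same (x (Fin.last n, .anc)) 0 * (∏ i, t (out o i))
          * defectWord A (fun i => (B (g (out o i)) : Matrix (Fin D) (Fin D) ℂ)) m l₀
            (x (Fin.last n, .right)) := by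
      intro l₀ m
      rw [collapse, if_pos fun w => (hcond l₀ m w).trans (hx w), fusionLayer_mulVec P ht, ← hout]
      rfl
    refine Eq.trans ?_ (congrArg (entangledState A (fun i => x (i, .phys)) (x (0, .left))
      (x (Fin.last n, .right)) * ·) (if_pos hx)).symm
    beta_reduce
    simp only [hterm]
    have hword : ∑ l₀, ((Q o)⁻¹ : Matrix.unitaryGroup (Fin D) ℂ).1 (x (0, .left)) l₀
        * ∑ m : Fin (n + 1) → Fin d,
          (∏ i, (K o i : Matrix (Fin d) (Fin d) ℂ) (x (i, .phys)) (m i))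
          * defectWord A (fun i => (B (g (out o i)) : Matrix (Fin D) (Fin D) ℂ)) m l₀
            (x (Fin.last n, .right))
        = word A (fun i => x (i, .phys)) (x (0, .left)) (x (Fin.last n, .right)) := by
      have h1 := congrArg (fun M => ((Q o)⁻¹ : Matrix.unitaryGroup (Fin D) ℂ).1 * M)
        (hK o fun i => x (i, .phys))
      have h2 : ((Q o)⁻¹ : Matrix.unitaryGroup (Fin D) ℂ).1 * (Q o).1 = 1 := by
        rw [← Matrix.UnitaryGroup.mul_val, inv_mul_cancel, Matrix.UnitaryGroup.one_val]
      simp only [← Matrix.mul_assoc, h2, one_mul] at h1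
      have h3 := congrFun (congrFun h1 (x (0, .left))) (x (Fin.last n, .right))
      rw [Matrix.mul_apply] at h3
      rw [← h3]
      refine Finset.sum_congr rfl fun l₀ _ => ?_
      rw [Matrix.sum_apply]
      rfl
    rw [entangledState, ← hword, ← hs]
    simp only [Finset.mul_sum, Finset.sum_mul]
    refine Finset.sum_congr rfl fun l₀ _ => Finset.sum_congr rfl fun m _ => ?_
    ring
  · refine Eq.trans ?_ (congrArg (entangledState A (fun i => x (i, .phys)) (x (0, .left))
      (x (Fin.last n, .right)) * ·) (if_neg hx)).symm
    rw [mul_zero]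
    refine Finset.sum_eq_zero fun l₀ _ => Finset.sum_eq_zero fun m _ => ?_
    rw [collapse, if_neg, mul_zero]
    intro h
    exact hx fun w => (hcond l₀ m w).symm.trans (h w)

end MPS

end

theorem corollary2 {D d : ℕ} [NeZero D] [NeZero d] {G : Type*} [Group G] [Fintype G]
    (A : Fin d → Matrix (Fin D) (Fin D) ℂ) (hcan : MPS.LeftCanonical A) (hnormal : MPS.IsNormal A)
    (X : Matrix (Fin D) (Fin D) ℂ) (hX : X ≠ 0)
    (U : G →* Matrix.unitaryGroup (Fin d) ℂ) (hsym : MPS.HasOnSiteSymmetry A X U) :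
    (∃ (V : G → Matrix.unitaryGroup (Fin D) ℂ) (c : G → Circle), MPS.ActsVirtually A U V c) ∧
    ∀ (V : G → Matrix.unitaryGroup (Fin D) ℂ) (c : G → Circle), MPS.ActsVirtually A U V c →
      MPS.IsProjectiveRep V ∧ (∀ g h : G, c (g * h) = c g * c h) ∧
      (MPS.IsIrreducible V →
        MPS.DefectsCorrectable A V ∧ MPS.IsPOVM V ∧ MPS.PreparedByProtocol A V ∧
          MPS.EdgeMeasurement A) := by
  refine ⟨MPS.exists_actsVirtually hcan hnormal hX U hsym, fun V c h => ?_⟩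
  have hproj := h.isProjectiveRep hcan hnormal
  refine ⟨hproj, fun g k => (h.mul_eq hcan hnormal g k).1, fun hV => ?_⟩
  have hpovm := hproj.isPOVM hV
  exact ⟨h.defectsCorrectable hcan hnormal, hpovm,
    MPS.preparedByProtocol_of_pushable hcan hpovm h.pushable,
    MPS.edgeMeasurement_of_canonical hcan (h.rightCanonical hcan hV) hnormal⟩
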